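/- Let $\mathbf z_1,\mathbf z_2,\dots$ be independent, identically distributed random vectors in $\mathbb R^p$ whose components $z_{i1},\dots,z_{ip}$ are mutually independent with $E(z_{ik})=0$ and $E(z_{ik}^2)=1$. Write $\gamma_k=E(z_{ik}^3)$, $\beta_k=E(z_{ik}^4)$, $\kappa_k=\beta_k-3$, and \[ \hat s_{kl}=\frac1n\sum_{i=1}^n z_{ik}z_{il},\qquad \hat r_{kl}=\frac1n\sum_{i=1}^n (z_{ik}^2-1)z_{il},\qquad \hat q_{kl}=\frac1n\sum_{i=1}^n (z_{ik}^3-\gamma_k)z_{il}, \] \[ \hat\psi_{1kl}=\gamma_k\hat r_{kl}-\gamma_l\hat r_{lk}-\gamma_k^2\hat s_{kl},\qquad \hat\psi_{2kl}=\kappa_k\hat q_{kl}-\kappa_l\hat q_{lk}-(\kappa_k\beta_k-3\kappa_l)\hat s_{kl}. \] For a univariate random variable $x$ let $x_{st}=(x-E x)/\sqrt{\mathrm{Var}(x)}$, $\gamma(x)=E(x_{st}^3)$ and $\kappa(x)=E(x_{st}^4)-3$. For $\alpha\in[0,1]$ and a random vector $\mathbf x$ in $\mathbb R^p$ with nonsingular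 covariance matrix $\boldsymbol\Sigma$, let $\boldsymbol\Sigma^{-1/2}$ be the symmetric positive definite matrix $\mathbf G$ with $\mathbf G\boldsymbol\Sigma\mathbf G=\mathbf I_p$, and $\mathbf x_{st}=\boldsymbol\Sigma^{-1/2}(\mathbf x-E\mathbf x)$. A symmetric projection pursuit matrix of the distribution of $\mathbf x$ with weight $\alpha$ is any matrix $\mathbf W=\mathbf U\boldsymbol\Sigma^{-1/2}$, where $\mathbf U=(\mathbf u_1,\dots,\mathbf u_p)^T$ maximizes \[ \alpha\sum_{k=1}^p\gamma^2(\mathbf u_k^T\mathbf x_{st})+(1-\alpha)\sum_{k=1}^p\kappa^2(\mathbf u_k^T\mathbf x_{st}) \] over all orthogonal $p\times p$ matrices. A sequence of solutions with weight $\alpha$ is a sequence of measurable functions $\hat{\mathbf W}=\hat{\mathbf W}_n(\mathbf z_1,\dots,\mathbf z_n)$ of the data, with values in $\mathbb R^{p\times p}$, such that $\hat{\mathbf W}_n$ is a symmetric projection pursuit matrix with weight $\alpha$ of the empirical distribution of the data whenever the covariance matrix of the latter is nonsingular. All limits are for $n\to\infty$. (i) If the $z_{ik}$ have finite sixth moments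 and at most one of $\gamma_1,\dots,\gamma_p$ is zero, then there exists a sequence of solutions with weight $\alpha=1$ such that $\hat{\mathbf W}\to_P\mathbf I_p$ and \[ \sqrt n(\hat w_{kk}-1)=-\tfrac12\sqrt n(\hat s_{kk}-1)+o_P(1),\qquad \sqrt n\,\hat w_{kl}=\frac{\sqrt n\,\hat\psi_{1kl}}{\gamma_k^2+\gamma_l^2}+o_P(1),\quad l\ne k. \] (ii) If the $z_{ik}$ have finite eighth moments and at most one of $\kappa_1,\dots,\kappa_p$ is zero, then there exists a sequence of solutions with weight $\alpha=0$ such that $\hat{\mathbf W}\to_P\mathbf I_p$ and \[ \sqrt n(\hat w_{kk}-1)=-\tfrac12\sqrt n(\hat s_{kk}-1)+o_P(1),\qquad \sqrt n\,\hat w_{kl}=\frac{\sqrt n\,\hat\psi_{2kl}}{\kappa_k^2+\kappa_l^2}+o_P(1),\quad l\ne k. \] (iii) If $0<\alpha<1$, the $z_{ik}$ have finite eighth moments, and $\gamma_k=\kappa_k=0$ for at most one $k$, then there exists a sequence of solutions with weight $\alpha$ such that $\hat{\mathbf W}\to_P\mathbf I_p$ and \[ \sqrt n(\hat w_{kk}-1)=-\tfrac12\sqrt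 n(\hat s_{kk}-1)+o_P(1),\qquad \sqrt n\,\hat w_{kl}=\frac{3\alpha\sqrt n\,\hat\psi_{1kl}+4(1-\alpha)\sqrt n\,\hat\psi_{2kl}}{3\alpha(\gamma_k^2+\gamma_l^2)+4(1-\alpha)(\kappa_k^2+\kappa_l^2)}+o_P(1),\quad l\ne k. \] -/

import Mathlib

open MeasureTheory ProbabilityTheory Filter
open scoped ENNReal Matrix

noncomputable section

namespace SymPP

/-! ### Univariate cumulants and the symmetric projection pursuit functional -/

/-- Skewness `γ(X) = E[X_st ^ 3]`, where `X_st = (X - E X) / √(Var X)`. -/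
def skewness {E : Type*} [MeasurableSpace E] (X : E → ℝ) (μ : Measure E) : ℝ :=
  ∫ x, ((X x - ∫ y, X y ∂μ) / √(variance X μ)) ^ 3 ∂μ

/-- Excess kurtosis `κ(X) = E[X_st ^ 4] - 3`. -/
def excessKurtosis {E : Type*} [MeasurableSpace E] (X : E → ℝ) (μ : Measure E) : ℝ :=
  (∫ x, ((X x - ∫ y, X y ∂μ) / √(variance X μ)) ^ 4 ∂μ) - 3

/-- Mean vector of a distribution on `ℝ^p`. -/
def meanVec {p : ℕ} (μ : Measure (Fin p → ℝ)) : Fin p → ℝ :=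
  fun k => ∫ x, x k ∂μ

/-- Covariance matrix of a distribution on `ℝ^p`. -/
def covMat {p : ℕ} (μ : Measure (Fin p → ℝ)) : Matrix (Fin p) (Fin p) ℝ :=
  Matrix.of fun k l => covariance (fun x => x k) (fun x => x l) μ

/-- `G = S^{-1/2}`: the symmetric positive definite matrix with `G S G = I`. -/
def IsInvSqrt {p : ℕ} (G S : Matrix (Fin p) (Fin p) ℝ) : Prop :=
  G.PosDef ∧ G * S * G = 1

/-- The projection pursuit index
`α ∑ₖ γ²(uₖᵀ x_st) + (1 - α) ∑ₖ κ²(uₖᵀ x_st)`, where `x_st = G (x - E x)`, the vector `x` has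
distribution `μ`, and `uₖ` is the `k`-th row of `U`. -/
def objective {p : ℕ} (α : ℝ) (μ : Measure (Fin p → ℝ)) (G U : Matrix (Fin p) (Fin p) ℝ) : ℝ :=
  α * ∑ k, skewness (fun x => U k ⬝ᵥ (G *ᵥ (x - meanVec μ))) μ ^ 2 +
    (1 - α) * ∑ k, excessKurtosis (fun x => U k ⬝ᵥ (G *ᵥ (x - meanVec μ))) μ ^ 2

/-- `W` is a value at `μ` of the symmetric projection pursuit functional with weight `α`:
`W = U Σ^{-1/2}`, where `Σ` is the covariance matrix of `μ` and the orthogonal matrix `U`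
maximizes the index over all orthogonal matrices. -/
def IsSymPP {p : ℕ} (α : ℝ) (μ : Measure (Fin p → ℝ)) (W : Matrix (Fin p) (Fin p) ℝ) : Prop :=
  ∃ G U : Matrix (Fin p) (Fin p) ℝ,
    IsInvSqrt G (covMat μ) ∧
    U ∈ Matrix.orthogonalGroup (Fin p) ℝ ∧
    (∀ V ∈ Matrix.orthogonalGroup (Fin p) ℝ, objective α μ G V ≤ objective α μ G U) ∧
    W = U * G

/-! ### Samples and estimates -/

/-- Empirical distribution `Fₙ` of the data points `x₁, …, xₙ`. -/
def empirical {p n : ℕ} (x : Fin n → Fin p → ℝ) : Measure (Fin p → ℝ) :=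
  (n : ℝ≥0∞)⁻¹ • ∑ i, Measure.dirac (x i)

/-- A sequence of solutions with weight `α`: for every sample size `n` a measurable function of
the data whose value is a symmetric projection pursuit matrix of the empirical distribution,
whenever the sample covariance matrix is nonsingular (so that the data can be standardized). -/
def IsSolutionSequence {p : ℕ} (α : ℝ)
    (W : (n : ℕ) → (Fin n → Fin p → ℝ) → Matrix (Fin p) (Fin p) ℝ) : Prop :=
  ∀ n, (∀ k l, Measurable fun x => W n x k l) ∧
    ∀ x, (covMat (empirical x)).PosDef → IsSymPP α (empirical x) (W n x)

/-- The first `n` observations. -/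
def sample {Ω : Type*} {p : ℕ} (z : ℕ → Ω → Fin p → ℝ) (n : ℕ) (ω : Ω) : Fin n → Fin p → ℝ :=
  fun i => z i ω

/-! ### Moments and sample moments -/

/-- `γₖ = E(zₖ³)`. -/
def gam {Ω : Type*} [MeasurableSpace Ω] {p : ℕ} (P : Measure Ω) (Z : Ω → Fin p → ℝ)
    (k : Fin p) : ℝ :=
  ∫ ω, Z ω k ^ 3 ∂P

/-- `βₖ = E(zₖ⁴)`. -/
def bet {Ω : Type*} [MeasurableSpace Ω] {p : ℕ} (P : Measure Ω) (Z : Ω → Fin p → ℝ)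
    (k : Fin p) : ℝ :=
  ∫ ω, Z ω k ^ 4 ∂P

/-- `κₖ = E(zₖ⁴) - 3`. -/
def kap {Ω : Type*} [MeasurableSpace Ω] {p : ℕ} (P : Measure Ω) (Z : Ω → Fin p → ℝ)
    (k : Fin p) : ℝ :=
  bet P Z k - 3

/-- `ŝₖₗ = n⁻¹ ∑ᵢ zᵢₖ zᵢₗ`. -/
def sHat {p n : ℕ} (x : Fin n → Fin p → ℝ) (k l : Fin p) : ℝ :=
  (n : ℝ)⁻¹ * ∑ i, x i k * x i l

/-- `r̂ₖₗ = n⁻¹ ∑ᵢ (zᵢₖ² - 1) zᵢₗ`. -/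
def rHat {p n : ℕ} (x : Fin n → Fin p → ℝ) (k l : Fin p) : ℝ :=
  (n : ℝ)⁻¹ * ∑ i, (x i k ^ 2 - 1) * x i l

/-- `q̂ₖₗ = n⁻¹ ∑ᵢ (zᵢₖ³ - γₖ) zᵢₗ`, for a given vector `γ`. -/
def qHat {p n : ℕ} (γ : Fin p → ℝ) (x : Fin n → Fin p → ℝ) (k l : Fin p) : ℝ :=
  (n : ℝ)⁻¹ * ∑ i, (x i k ^ 3 - γ k) * x i l

/-- `ψ̂₁ₖₗ = γₖ r̂ₖₗ - γₗ r̂ₗₖ - γₖ² ŝₖₗ`. -/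
def psi1 {p n : ℕ} (γ : Fin p → ℝ) (x : Fin n → Fin p → ℝ) (k l : Fin p) : ℝ :=
  γ k * rHat x k l - γ l * rHat x l k - γ k ^ 2 * sHat x k l

/-- `ψ̂₂ₖₗ = κₖ q̂ₖₗ - κₗ q̂ₗₖ - (κₖ βₖ - 3 κₗ) ŝₖₗ`. -/
def psi2 {p n : ℕ} (γ β κ : Fin p → ℝ) (x : Fin n → Fin p → ℝ) (k l : Fin p) : ℝ :=
  κ k * qHat γ x k l - κ l * qHat γ x l k - (κ k * β k - 3 * κ l) * sHat x k l

/-! ### Convergence in probability -/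

/-- `Xₙ = o_P(1)`. -/
def IsLittleOP {Ω : Type*} [MeasurableSpace Ω] (P : Measure Ω) (X : ℕ → Ω → ℝ) : Prop :=
  TendstoInMeasure P X atTop fun _ => 0

/-- Convergence in probability of random matrices to a constant matrix (entrywise, which is
convergence in any matrix norm). -/
def TendstoInProb {Ω : Type*} [MeasurableSpace Ω] {p : ℕ} (P : Measure Ω)
    (M : ℕ → Ω → Matrix (Fin p) (Fin p) ℝ) (A : Matrix (Fin p) (Fin p) ℝ) : Prop :=
  ∀ k l, TendstoInMeasure P (fun n ω => M n ω k l) atTop fun _ => A k l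

end SymPP

end

noncomputable section

namespace SymPP

open scoped Topology

/-! ### Sample moments of the empirical distribution -/

/-! All three parts are instances of one statement, `exists_consistent_solutionSequence`, for a
weight `α` in `[0, 1]`. Since `Σ^{-1/2}` only fixes a base point, the solutions are exactly the
matrices `W` that whiten the data and maximize the index on their orbit under left multiplication by
orthogonal matrices (`IsOpt`). These form a compact set whose graph over the data is closed. Among
them one closest to the identity can be chosen measurably (`exists_solutionSequence`); this resolves
the ambiguity of sign and order.

Consistency is proved path by path. By the strong law all sample moments up to order four converge
almost surely. In the limit the index of an orthogonal `U` is at most `∑ cⱼ ∑ₖ Uₖⱼ⁴` with `cⱼ = αγⱼ²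
+ (1 - α)κⱼ²`, by Cauchy–Schwarz. This is at most `∑ cⱼ`, the value at the identity, and since at
most one `cⱼ` vanishes, equality forces a signed permutation. Signed permutations leave the sample
index unchanged, so undoing a limiting one gives a solution near the identity, and the closest
solution must itself converge to the identity (`CenteredMomentsConverge.tendsto_one`).

For the expansions, rotating rows `k` and `l` in their plane yields a stationarity equation
(`IsOpt.first_order`). This equation and the whitening equation are linearized at the identity, with
errors of smaller order than the `gauge`, that is, deviation of `W` plus sampling noise. Solving the
linear system gives the leading terms, which are of the order of the noise alone, so the deviation
can be absorbed (`gauge_isBigO_noise`). Finally `√n` times the noise is bounded in `L¹`, and an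
almost sure little-o of such a sequence is `o_P(1)` (`isLittleOP_of_ae_isLittleO`). -/

/-- Sample mean of `f`. -/
def emean {p n : ℕ} (x : Fin n → Fin p → ℝ) (f : (Fin p → ℝ) → ℝ) : ℝ :=
  (n : ℝ)⁻¹ * ∑ i, f (x i)

/-- Sample mean vector. -/
def xbar {p n : ℕ} (x : Fin n → Fin p → ℝ) : Fin p → ℝ :=
  fun k => emean x fun y => y k

/-- Centered sample moment of order two of the linear forms `u`, `v`. -/
def c2 {p n : ℕ} (x : Fin n → Fin p → ℝ) (u v : Fin p → ℝ) : ℝ :=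
  emean x fun y => (u ⬝ᵥ (y - xbar x)) * (v ⬝ᵥ (y - xbar x))

/-- Centered sample moment of order three of the linear forms `u`, `v`, `w`. -/
def c3 {p n : ℕ} (x : Fin n → Fin p → ℝ) (u v w : Fin p → ℝ) : ℝ :=
  emean x fun y => (u ⬝ᵥ (y - xbar x)) * (v ⬝ᵥ (y - xbar x)) * (w ⬝ᵥ (y - xbar x))

/-- Centered sample moment of order four of the linear forms `u`, `v`, `w`, `t`. -/
def c4 {p n : ℕ} (x : Fin n → Fin p → ℝ) (u v w t : Fin p → ℝ) : ℝ :=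
  emean x fun y => (u ⬝ᵥ (y - xbar x)) * (v ⬝ᵥ (y - xbar x)) * (w ⬝ᵥ (y - xbar x)) *
    (t ⬝ᵥ (y - xbar x))

/-- Sample covariance matrix. -/
def scov {p n : ℕ} (x : Fin n → Fin p → ℝ) : Matrix (Fin p) (Fin p) ℝ :=
  Matrix.of fun k l => emean x fun y => (y k - xbar x k) * (y l - xbar x l)

/-- The sample projection pursuit index of an unmixing matrix. -/
def index {p n : ℕ} (α : ℝ) (x : Fin n → Fin p → ℝ) (W : Matrix (Fin p) (Fin p) ℝ) : ℝ :=
  α * ∑ k, c3 x (W k) (W k) (W k) ^ 2 + (1 - α) * ∑ k, (c4 x (W k) (W k) (W k) (W k) - 3) ^ 2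

/-- `W` standardizes the data and is optimal among its rotations. -/
def IsOpt {p n : ℕ} (α : ℝ) (x : Fin n → Fin p → ℝ) (W : Matrix (Fin p) (Fin p) ℝ) : Prop :=
  W * scov x * Wᵀ = 1 ∧
    ∀ O ∈ Matrix.orthogonalGroup (Fin p) ℝ, index α x (O * W) ≤ index α x W

section Sample

variable {p n : ℕ} (x : Fin n → Fin p → ℝ)

theorem emean_add (f g : (Fin p → ℝ) → ℝ) :
    emean x (fun y => f y + g y) = emean x f + emean x g := by
  simp only [emean, Finset.sum_add_distrib, mul_add]

theorem emean_sub (f g : (Fin p → ℝ) → ℝ) :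
    emean x (fun y => f y - g y) = emean x f - emean x g := by
  simp only [emean, Finset.sum_sub_distrib, mul_sub]

theorem emean_const_mul (c : ℝ) (f : (Fin p → ℝ) → ℝ) :
    emean x (fun y => c * f y) = c * emean x f := by
  simp only [emean, ← Finset.mul_sum]; ring

theorem emean_sum {ι : Type*} (s : Finset ι) (f : ι → (Fin p → ℝ) → ℝ) :
    emean x (fun y => ∑ j ∈ s, f j y) = ∑ j ∈ s, emean x (f j) := by
  simp only [emean]
  rw [Finset.sum_comm, Finset.mul_sum]

theorem emean_const (hn : n ≠ 0) (c : ℝ) : emean x (fun _ => c) = c := by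
  have : (n : ℝ) ≠ 0 := by exact_mod_cast hn
  simp [emean, this]

/-- No regularity of `f` is needed, because any real function is integrable against a point mass
here. For `n = 0` both sides are zero: the sum of measures is empty. -/
theorem integral_empirical (f : (Fin p → ℝ) → ℝ) :
    ∫ y, f y ∂(empirical x) = emean x f := by
  rw [empirical, integral_smul_measure, integral_finsetSum_measure]
  · simp [emean, integral_dirac]
  · intro i _
    exact integrable_dirac (by simp [enorm_lt_top])

theorem meanVec_empirical : meanVec (empirical x) = xbar x := by
  ext k
  rw [meanVec, integral_empirical]; rfl

theorem covMat_empirical : covMat (empirical x) = scov x := by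
  ext k l
  rw [covMat, Matrix.of_apply, covariance]
  simp only [integral_empirical]
  rfl

theorem emean_centered (u : Fin p → ℝ) : emean x (fun y => u ⬝ᵥ (y - xbar x)) = 0 := by
  have h : ∀ k, emean x (fun y => y k - xbar x k) = 0 := by
    intro k
    rcases Nat.eq_zero_or_pos n with rfl | hn
    · simp [emean]
    · rw [emean_sub, emean_const x hn.ne']; simp [xbar]
  simp only [dotProduct, emean_sum, emean_const_mul, Pi.sub_apply, h, mul_zero,
    Finset.sum_const_zero]

/-- Bilinearity of the centered second moment. It turns the whitening condition `W S Wᵀ = 1` into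
orthonormality of the rows of `W` for `c2`. -/
theorem c2_eq_mul_scov (W V : Matrix (Fin p) (Fin p) ℝ) (k l : Fin p) :
    (W * scov x * Vᵀ) k l = c2 x (W k) (V l) := by
  simp only [c2, dotProduct, Finset.sum_mul_sum, emean_sum, Pi.sub_apply]
  simp only [Matrix.mul_apply, scov, Matrix.of_apply, Matrix.transpose_apply, Finset.sum_mul]
  rw [Finset.sum_comm]
  refine Finset.sum_congr rfl fun i _ => Finset.sum_congr rfl fun j _ => ?_
  rw [mul_right_comm, ← emean_const_mul]
  congr 1; ext y; ring

theorem c2_of_standardized {W : Matrix (Fin p) (Fin p) ℝ} (hW : W * scov x * Wᵀ = 1)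
    (k l : Fin p) : c2 x (W k) (W l) = if k = l then 1 else 0 := by
  rw [← c2_eq_mul_scov, hW, Matrix.one_apply]

theorem variance_empirical_centered (u : Fin p → ℝ) :
    variance (fun y => u ⬝ᵥ (y - xbar x)) (empirical x) = c2 x u u := by
  rw [variance_eq_integral (by unfold dotProduct; fun_prop)]
  simp only [integral_empirical, emean_centered, c2]
  congr 1; ext y; ring

/-- The whitening hypothesis gives every projection sample mean zero and variance one, so the
standardization inside skewness and kurtosis does nothing, and only the product `V * G` matters. -/
theorem objective_empirical (α : ℝ) (G V : Matrix (Fin p) (Fin p) ℝ)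
    (h : (V * G) * scov x * (V * G)ᵀ = 1) :
    objective α (empirical x) G V = index α x (V * G) := by
  have e : ∀ k y, V k ⬝ᵥ (G *ᵥ y) = (V * G) k ⬝ᵥ y := by
    intro k y
    rw [Matrix.dotProduct_mulVec]; rfl
  have hv : ∀ k, variance (fun y => (V * G) k ⬝ᵥ (y - xbar x)) (empirical x) = 1 := by
    intro k
    rw [variance_empirical_centered, c2_of_standardized x h, if_pos rfl]
  simp only [objective, skewness, excessKurtosis, meanVec_empirical, e, hv, integral_empirical,
    emean_centered, Real.sqrt_one, sub_zero, div_one, index, c3, c4]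
  congr 5 <;> (ext k; congr 3; ext y; ring)

/-! ### Whitening matrices and their orthogonal orbit -/

theorem exists_isInvSqrt {S : Matrix (Fin p) (Fin p) ℝ} (hS : S.PosDef) : ∃ G, IsInvSqrt G S := by
  open scoped MatrixOrder Matrix.Norms.L2Operator in
  have h0 : (0 : Matrix (Fin p) (Fin p) ℝ) ≤ S⁻¹ := by
    rw [Matrix.nonneg_iff_posSemidef]; exact hS.inv.posSemidef
  have hG : CFC.sqrt S⁻¹ * CFC.sqrt S⁻¹ = S⁻¹ := CFC.sqrt_mul_sqrt_self _ h0
  have h1 : S * CFC.sqrt S⁻¹ * CFC.sqrt S⁻¹ = 1 := by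
    rw [mul_assoc, hG, Matrix.mul_nonsing_inv _ ((Matrix.isUnit_iff_isUnit_det _).1 hS.isUnit)]
  have h2 : CFC.sqrt S⁻¹ * (S * CFC.sqrt S⁻¹) = 1 := mul_eq_one_comm.1 h1
  refine ⟨CFC.sqrt S⁻¹, ?_, by rw [mul_assoc, h2]⟩
  have hp : (CFC.sqrt S⁻¹).PosSemidef := by
    rw [← Matrix.nonneg_iff_posSemidef]; exact CFC.sqrt_nonneg _
  exact hp.posDef_iff_isUnit.2 (IsUnit.of_mul_eq_one _ h2)

/-- The factor is `O = W S Vᵀ`, since `S Vᵀ` inverts `V`. Thus the whitening matrices of `S` form a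
single orbit of the orthogonal group. -/
theorem orthogonal_of_standardized {S W V : Matrix (Fin p) (Fin p) ℝ} (hW : W * S * Wᵀ = 1)
    (hV : V * S * Vᵀ = 1) : ∃ O ∈ Matrix.orthogonalGroup (Fin p) ℝ, W = O * V := by
  have hV' : S * Vᵀ * V = 1 := by
    rw [mul_assoc] at hV; exact mul_eq_one_comm.1 hV
  refine ⟨W * S * Vᵀ, ?_, by rw [mul_assoc, mul_assoc, ← mul_assoc S, hV', mul_one]⟩
  rw [Matrix.mem_orthogonalGroup_iff]
  calc W * S * Vᵀ * (W * S * Vᵀ)ᵀ = W * (S * Vᵀ * V) * (Sᵀ * Wᵀ) := by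
        simp only [Matrix.transpose_mul, Matrix.transpose_transpose, mul_assoc]
    _ = (W * S * Wᵀ)ᵀ := by
        rw [hV', mul_one]
        simp only [Matrix.transpose_mul, Matrix.transpose_transpose, mul_assoc]
    _ = 1 := by rw [hW, Matrix.transpose_one]

theorem orthogonal_mul_transpose {O : Matrix (Fin p) (Fin p) ℝ}
    (hO : O ∈ Matrix.orthogonalGroup (Fin p) ℝ) : O * Oᵀ = 1 := by
  rwa [Matrix.mem_orthogonalGroup_iff] at hO

theorem mem_orthogonalGroup_of {O : Matrix (Fin p) (Fin p) ℝ} (hO : O * Oᵀ = 1) :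
    O ∈ Matrix.orthogonalGroup (Fin p) ℝ := by
  rwa [Matrix.mem_orthogonalGroup_iff]

theorem standardized_mul {S O W : Matrix (Fin p) (Fin p) ℝ}
    (hO : O ∈ Matrix.orthogonalGroup (Fin p) ℝ) (hW : W * S * Wᵀ = 1) :
    (O * W) * S * (O * W)ᵀ = 1 := by
  calc (O * W) * S * (O * W)ᵀ = O * (W * S * Wᵀ) * Oᵀ := by
        simp only [Matrix.transpose_mul, mul_assoc]
    _ = 1 := by rw [hW, mul_one, orthogonal_mul_transpose hO]

theorem IsInvSqrt.standardized {G S : Matrix (Fin p) (Fin p) ℝ} (h : IsInvSqrt G S) :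
    G * S * Gᵀ = 1 := by
  have : Gᵀ = G := by
    rw [← Matrix.conjTranspose_eq_transpose_of_trivial]; exact h.1.1
  rw [this, h.2]

/-- Both `G` and `W` whiten the data, so the matrices `V * G` with `V` orthogonal are the same as
the `O * W`. Hence the inverse square root can be dropped and optimality studied as a condition on
`W` alone. -/
theorem IsOpt.isSymPP {α : ℝ} {x : Fin n → Fin p → ℝ} {W : Matrix (Fin p) (Fin p) ℝ}
    (h : IsOpt α x W) (hS : (covMat (empirical x)).PosDef) : IsSymPP α (empirical x) W := by
  obtain ⟨G, hG⟩ := exists_isInvSqrt hS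
  have hG1 : G * scov x * Gᵀ = 1 := by rw [← covMat_empirical]; exact hG.standardized
  obtain ⟨U, hU, rfl⟩ := orthogonal_of_standardized h.1 hG1
  refine ⟨G, U, hG, hU, fun V hV => ?_, rfl⟩
  rw [objective_empirical x α G V (standardized_mul hV hG1), objective_empirical x α G U h.1]
  obtain ⟨O, hO, e⟩ := orthogonal_of_standardized (standardized_mul hV hG1) h.1
  rw [e]
  exact h.2 O hO

/-! ### Compactness and closed graph of the set of optimal matrices -/

theorem isCompact_orthogonalGroup :
    IsCompact (Matrix.orthogonalGroup (Fin p) ℝ : Set (Matrix (Fin p) (Fin p) ℝ)) := by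
  have hb : IsCompact (Set.pi Set.univ fun _ : Fin p => Set.pi Set.univ fun _ : Fin p =>
      Set.Icc (-1 : ℝ) 1) :=
    isCompact_univ_pi fun _ => isCompact_univ_pi fun _ => isCompact_Icc
  refine IsCompact.of_isClosed_subset hb ?_ ?_
  · have : (Matrix.orthogonalGroup (Fin p) ℝ : Set (Matrix (Fin p) (Fin p) ℝ)) =
        {O | O * Oᵀ = 1} :=
      Set.ext fun O => ⟨orthogonal_mul_transpose, mem_orthogonalGroup_of⟩
    rw [this]
    exact isClosed_eq (by fun_prop) continuous_const
  · intro O hO k _ l _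
    have := entry_norm_bound_of_unitary (𝕜 := ℝ) hO k l
    rwa [Real.norm_eq_abs, abs_le] at this

theorem continuous_xbar : Continuous fun x : Fin n → Fin p → ℝ => xbar x := by
  unfold xbar emean; fun_prop

theorem continuous_centered :
    Continuous fun q : (Fin n → Fin p → ℝ) × Matrix (Fin p) (Fin p) ℝ =>
      fun (k : Fin p) (i : Fin n) => q.2 k ⬝ᵥ (q.1 i - xbar q.1) := by
  have := continuous_xbar (p := p) (n := n)
  unfold dotProduct
  simp only [Pi.sub_apply]
  refine continuous_pi fun k => continuous_pi fun i => continuous_finsetSum _ fun j _ => ?_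
  refine Continuous.mul ((continuous_apply_apply k j).comp continuous_snd) ?_
  have h1 : Continuous fun q : (Fin n → Fin p → ℝ) × Matrix (Fin p) (Fin p) ℝ => xbar q.1 :=
    this.comp continuous_fst
  fun_prop

theorem continuous_index (α : ℝ) :
    Continuous fun q : (Fin n → Fin p → ℝ) × Matrix (Fin p) (Fin p) ℝ => index α q.1 q.2 := by
  have h : ∀ k i, Continuous fun q : (Fin n → Fin p → ℝ) × Matrix (Fin p) (Fin p) ℝ =>
      q.2 k ⬝ᵥ (q.1 i - xbar q.1) := fun k i =>
    (continuous_apply_apply k i).comp continuous_centered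
  unfold index c3 c4 emean
  fun_prop

theorem continuous_index_comp {X : Type*} [TopologicalSpace X] (α : ℝ)
    {f : X → Fin n → Fin p → ℝ} {g : X → Matrix (Fin p) (Fin p) ℝ} (hf : Continuous f)
    (hg : Continuous g) : Continuous fun a => index α (f a) (g a) :=
  Continuous.comp (g := fun q : (Fin n → Fin p → ℝ) × Matrix (Fin p) (Fin p) ℝ => index α q.1 q.2)
    (f := fun a => (f a, g a)) (continuous_index α) (hf.prodMk hg)

theorem continuous_scov : Continuous fun x : Fin n → Fin p → ℝ => scov x := by
  have := continuous_xbar (p := p) (n := n)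
  unfold scov emean
  refine continuous_matrix fun k l => ?_
  simp only [Matrix.of_apply]
  fun_prop

/-- A continuous equation and a family of weak inequalities, one per orthogonal matrix, each jointly
continuous in data and `W`. Joint closedness is what the measurable selection uses. -/
theorem isClosed_isOpt (α : ℝ) :
    IsClosed {q : (Fin n → Fin p → ℝ) × Matrix (Fin p) (Fin p) ℝ | IsOpt α q.1 q.2} := by
  have h1 : Continuous fun q : (Fin n → Fin p → ℝ) × Matrix (Fin p) (Fin p) ℝ => scov q.1 :=
    continuous_scov.comp continuous_fst
  have h2 : Continuous fun q : (Fin n → Fin p → ℝ) × Matrix (Fin p) (Fin p) ℝ =>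
      q.2 * scov q.1 * q.2ᵀ :=
    (continuous_snd.matrix_mul h1).matrix_mul continuous_snd.matrix_transpose
  have h3 : ∀ O : Matrix (Fin p) (Fin p) ℝ,
      Continuous fun q : (Fin n → Fin p → ℝ) × Matrix (Fin p) (Fin p) ℝ =>
        index α q.1 (O * q.2) := fun O =>
    continuous_index_comp α continuous_fst
      ((continuous_const (y := O)).matrix_mul continuous_snd)
  simp only [IsOpt, Set.ofPred_and, Set.ofPred_forall]
  exact (isClosed_eq h2 continuous_const).inter
    (isClosed_iInter fun O => isClosed_iInter fun _ => isClosed_le (h3 O) (continuous_index α))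

/-- If nonempty, the set lies in the orthogonal orbit of any one of its elements, a continuous image
of a compact group. -/
theorem isCompact_isOpt (α : ℝ) : IsCompact {W | IsOpt α x W} := by
  have hcl : IsClosed {W | IsOpt α x W} :=
    (isClosed_isOpt α).preimage (f := fun W => (x, W)) (by fun_prop)
  by_cases h : ∃ V, IsOpt α x V
  · obtain ⟨V, hV⟩ := h
    refine IsCompact.of_isClosed_subset
      ((isCompact_orthogonalGroup (p := p)).image (f := fun O => O * V) (by fun_prop)) hcl ?_
    intro W hW
    obtain ⟨O, hO, e⟩ := orthogonal_of_standardized hW.1 hV.1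
    exact ⟨O, hO, e.symm⟩
  · have : {W | IsOpt α x W} = ∅ := Set.eq_empty_of_forall_notMem fun W hW => h ⟨W, hW⟩
    rw [this]; exact isCompact_empty

theorem exists_isOpt (α : ℝ) (hS : (scov x).PosDef) : ∃ W, IsOpt α x W := by
  obtain ⟨G, hG⟩ := exists_isInvSqrt hS
  have hc : Continuous fun O : Matrix (Fin p) (Fin p) ℝ => index α x (O * G) :=
    continuous_index_comp α continuous_const (continuous_id.matrix_mul continuous_const)
  obtain ⟨U, hU, hmax⟩ := (isCompact_orthogonalGroup (p := p)).exists_isMaxOn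
    ⟨1, one_mem _⟩ hc.continuousOn
  refine ⟨U * G, standardized_mul hU hG.standardized, fun O hO => ?_⟩
  rw [← mul_assoc]
  exact hmax (mul_mem hO hU)

end Sample

/-! ### Measurable selection from compact-valued maps -/

/-- A set-valued map is hit-measurable if its closed sets are hit on measurable sets. -/
def HitMeasurable {X Y : Type*} [MeasurableSpace X] [TopologicalSpace Y] (K : X → Set Y) : Prop :=
  ∀ C : Set Y, IsClosed C → MeasurableSet {x | (K x ∩ C).Nonempty}

/-- The minimizers of `f` on `K`. -/
def argminOn {Y : Type*} (f : Y → ℝ) (K : Set Y) : Set Y := {y ∈ K | ∀ y' ∈ K, f y ≤ f y'}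

section Selection

variable {X Y : Type*} [MeasurableSpace X] [TopologicalSpace Y]

/-- A minimizer over `K` lies in `C` exactly when the minimum over `K ∩ C` does not exceed the
minimum over `K`. Comparing sublevel sets at rational levels suffices, which makes the condition
countable. -/
theorem argminOn_inter_nonempty_iff {K C : Set Y} (hK : IsCompact K) (hC : IsClosed C)
    {f : Y → ℝ} (hf : Continuous f) :
    (argminOn f K ∩ C).Nonempty ↔ (K ∩ C).Nonempty ∧
      ∀ q : ℚ, (K ∩ {y | f y ≤ q}).Nonempty → (K ∩ (C ∩ {y | f y ≤ q})).Nonempty := by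
  constructor
  · rintro ⟨y, ⟨hy, hmin⟩, hyC⟩
    refine ⟨⟨y, hy, hyC⟩, ?_⟩
    rintro q ⟨y', hy', hq⟩
    exact ⟨y, hy, hyC, (hmin y' hy').trans hq⟩
  · rintro ⟨hne, hq⟩
    obtain ⟨y, hy, hmin⟩ := (hK.inter_right hC).exists_isMinOn hne hf.continuousOn
    refine ⟨y, ⟨hy.1, fun y' hy' => ?_⟩, hy.2⟩
    by_contra! hlt
    obtain ⟨q, h1, h2⟩ := exists_rat_btwn hlt
    obtain ⟨y'', h3, h4, h5⟩ := hq q ⟨y', hy', h1.le⟩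
    exact absurd (hmin ⟨h3, h4⟩) (not_le.2 (lt_of_le_of_lt h5 h2))

theorem HitMeasurable.argminOn {K : X → Set Y} (h : HitMeasurable K) (hK : ∀ x, IsCompact (K x))
    {f : Y → ℝ} (hf : Continuous f) : HitMeasurable fun x => argminOn f (K x) := by
  intro C hC
  have hcl : ∀ q : ℚ, IsClosed {y | f y ≤ q} := fun q => isClosed_le hf continuous_const
  have : {x | (SymPP.argminOn f (K x) ∩ C).Nonempty} = {x | (K x ∩ C).Nonempty} ∩
      ⋂ q : ℚ, ({x | (K x ∩ {y | f y ≤ q}).Nonempty}ᶜ ∪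
        {x | (K x ∩ (C ∩ {y | f y ≤ q})).Nonempty}) := by
    ext x
    simp only [Set.mem_ofPred_eq, argminOn_inter_nonempty_iff (hK x) hC hf, Set.mem_inter_iff,
      Set.mem_iInter, Set.mem_union, Set.mem_compl_iff, imp_iff_not_or]
  rw [this]
  exact (h C hC).inter (MeasurableSet.iInter fun q =>
    (h _ (hcl q)).compl.union (h _ (hC.inter (hcl q))))

theorem isCompact_argminOn {K : Set Y} (hK : IsCompact K) {f : Y → ℝ} (hf : Continuous f) :
    IsCompact (argminOn f K) := by
  have : argminOn f K = K ∩ ⋂ y' ∈ K, {y | f y ≤ f y'} := by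
    ext y; simp [argminOn]
  rw [this]
  exact hK.inter_right (isClosed_biInter fun y' _ => isClosed_le hf continuous_const)

theorem argminOn_nonempty {K : Set Y} (hK : IsCompact K) (hne : K.Nonempty) {f : Y → ℝ}
    (hf : Continuous f) : (argminOn f K).Nonempty := by
  obtain ⟨y, hy, hmin⟩ := hK.exists_isMinOn hne hf.continuousOn
  exact ⟨y, hy, fun y' hy' => hmin hy'⟩

/-- Minimize the functions of the list one after the other. After each step the current function is
constant on what remains, and compactness keeps the remainder nonempty. -/
theorem exists_lexicographic_selection (fs : List (Y → ℝ)) (hfs : ∀ f ∈ fs, Continuous f)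
    (K : X → Set Y) (h : HitMeasurable K) (hK : ∀ x, IsCompact (K x)) :
    ∃ K' : X → Set Y, HitMeasurable K' ∧ (∀ x, K' x ⊆ K x) ∧
      (∀ x, (K x).Nonempty → (K' x).Nonempty) ∧
      ∀ f ∈ fs, ∀ x, ∀ y ∈ K' x, ∀ y' ∈ K' x, f y = f y' := by
  induction fs generalizing K with
  | nil => exact ⟨K, h, fun _ => subset_rfl, fun _ => id, by simp⟩
  | cons f fs ih =>
    have hf := hfs f (by simp)
    obtain ⟨K', h1, h2, h3, h4⟩ := ih (fun g hg => hfs g (by simp [hg]))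
      (fun x => argminOn f (K x)) (h.argminOn hK hf) (fun x => isCompact_argminOn (hK x) hf)
    refine ⟨K', h1, fun x => (h2 x).trans fun y hy => hy.1,
      fun x hx => h3 x (argminOn_nonempty (hK x) hx hf), ?_⟩
    intro g hg x y hy y' hy'
    rcases List.mem_cons.1 hg with rfl | hg
    · exact le_antisymm ((h2 x hy).2 y' (h2 x hy').1) ((h2 x hy').2 y (h2 x hy).1)
    · exact h4 g hg x y hy y' hy'

end Selection

/-- A compact-valued hit-measurable family of matrices has a measurable selection
of minimizers of a continuous function. -/
theorem exists_measurable_selection {X : Type*} [MeasurableSpace X] {p : ℕ}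
    (K : X → Set (Matrix (Fin p) (Fin p) ℝ)) (h : HitMeasurable K) (hK : ∀ x, IsCompact (K x))
    {f : Matrix (Fin p) (Fin p) ℝ → ℝ} (hf : Continuous f) :
    ∃ W : X → Matrix (Fin p) (Fin p) ℝ, (∀ k l, Measurable fun x => W x k l) ∧
      ∀ x, (K x).Nonempty → W x ∈ argminOn f (K x) := by
  classical
  -- The list consists of all matrix entries, so each `K' x` has at most one point.
  obtain ⟨K', h1, h2, h3, h4⟩ := exists_lexicographic_selection
    ((Finset.univ : Finset (Fin p × Fin p)).toList.map
      fun q (M : Matrix (Fin p) (Fin p) ℝ) => M q.1 q.2)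
    (by
      intro g hg
      obtain ⟨q, _, rfl⟩ := List.mem_map.1 hg
      exact continuous_apply_apply q.1 q.2)
    (fun x => argminOn f (K x)) (h.argminOn hK hf) (fun x => isCompact_argminOn (hK x) hf)
  have h5 : ∀ k l x, ∀ y ∈ K' x, ∀ y' ∈ K' x, y k l = y' k l := fun k l =>
    h4 (fun M => M k l) (List.mem_map.2 ⟨(k, l), by simp, rfl⟩)
  refine ⟨fun x => if hx : (K' x).Nonempty then hx.some else 0, fun k l => ?_, fun x hx => ?_⟩
  · refine measurable_of_Iic fun c => ?_
    have hn : MeasurableSet {x | (K' x).Nonempty} := by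
      simpa using h1 Set.univ isClosed_univ
    have hs : MeasurableSet {x | (K' x ∩ {M | M k l ≤ c}).Nonempty} :=
      h1 _ (isClosed_le (continuous_id.matrix_elem k l) continuous_const)
    -- Because entries are constant on `K' x`, the chosen element satisfies the bound as soon as
    -- some element does. Where `K' x` is empty the default value is the zero matrix, which accounts
    -- for the second set.
    have : (fun x => (if hx : (K' x).Nonempty then hx.some else 0 :
        Matrix (Fin p) (Fin p) ℝ) k l) ⁻¹' Set.Iic c =
        {x | (K' x ∩ {M | M k l ≤ c}).Nonempty} ∪
          ({x | (K' x).Nonempty}ᶜ ∩ {_x | (0 : ℝ) ≤ c}) := by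
      ext x
      by_cases hx : (K' x).Nonempty
      · simp only [Set.mem_preimage, hx, dite_true, Set.mem_Iic, Set.mem_union, Set.mem_ofPred_eq,
          Set.mem_inter_iff, Set.mem_compl_iff, not_true, false_and, or_false]
        exact ⟨fun hc => ⟨_, hx.some_mem, hc⟩, fun ⟨y, hy, hc⟩ =>
          (h5 k l x _ hx.some_mem y hy).trans_le hc⟩
      · simp only [Set.mem_preimage, hx, dite_false, Set.mem_Iic, Set.mem_union, Set.mem_ofPred_eq,
          Set.mem_inter_iff, Set.mem_compl_iff, not_false_iff, true_and, Matrix.zero_apply]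
        exact ⟨Or.inr, fun hh => hh.resolve_left fun ⟨y, hy, _⟩ => hx ⟨y, hy⟩⟩
    rw [this]
    exact hs.union (hn.compl.inter (MeasurableSet.const _))
  · have hx' : (K' x).Nonempty := h3 x (argminOn_nonempty (hK x) hx hf)
    simp only [hx', dite_true]
    exact h2 x hx'.some_mem

/-- Projection along a compact factor is a closed map. Exhausting `Y` by countably many compact sets
presents the hitting set as a countable union of closed sets. -/
theorem hitMeasurable_of_isClosed_graph {X : Type*} [TopologicalSpace X] [MeasurableSpace X]
    [BorelSpace X] {Y : Type*} [TopologicalSpace Y] [SigmaCompactSpace Y] {K : X → Set Y}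
    (h : IsClosed {q : X × Y | q.2 ∈ K q.1}) : HitMeasurable K := by
  intro C hC
  have : {x | (K x ∩ C).Nonempty} = ⋃ m : ℕ, Prod.fst ''
      {q : X × compactCovering Y m | (q.2 : Y) ∈ K q.1 ∧ (q.2 : Y) ∈ C} := by
    ext x
    simp only [Set.mem_ofPred_eq, Set.mem_iUnion, Set.mem_image]
    constructor
    · rintro ⟨y, hy, hyC⟩
      obtain ⟨m, hm⟩ := exists_mem_compactCovering y
      exact ⟨m, (x, ⟨y, hm⟩), ⟨hy, hyC⟩, rfl⟩
    · rintro ⟨m, ⟨x', y⟩, ⟨hy, hyC⟩, rfl⟩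
      exact ⟨y, hy, hyC⟩
  rw [this]
  refine MeasurableSet.iUnion fun m => IsClosed.measurableSet ?_
  have : CompactSpace (compactCovering Y m) :=
    isCompact_iff_compactSpace.1 (isCompact_compactCovering Y m)
  refine isClosedMap_fst_of_compactSpace _ (IsClosed.inter ?_ ?_)
  · exact h.preimage (f := fun q : X × compactCovering Y m => (q.1, (q.2 : Y))) (by fun_prop)
  · exact hC.preimage (f := fun q : X × compactCovering Y m => (q.2 : Y)) (by fun_prop)

/-- Squared distance from the identity matrix. -/
def distOne {p : ℕ} (W : Matrix (Fin p) (Fin p) ℝ) : ℝ :=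
  ∑ k, ∑ l, (W k l - (1 : Matrix (Fin p) (Fin p) ℝ) k l) ^ 2

theorem continuous_distOne {p : ℕ} : Continuous (distOne (p := p)) := by
  unfold distOne
  fun_prop

/-- There is a sequence of solutions that picks, among all solutions, one closest to the
identity matrix. -/
theorem exists_solutionSequence (p : ℕ) (α : ℝ) :
    ∃ W : (n : ℕ) → (Fin n → Fin p → ℝ) → Matrix (Fin p) (Fin p) ℝ,
      IsSolutionSequence α W ∧ ∀ n x, (scov x).PosDef →
        IsOpt α x (W n x) ∧ ∀ V, IsOpt α x V → distOne (W n x) ≤ distOne V := by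
  have hsel : ∀ n, ∃ W : (Fin n → Fin p → ℝ) → Matrix (Fin p) (Fin p) ℝ,
      (∀ k l, Measurable fun x => W x k l) ∧
        ∀ x, {V | IsOpt α x V}.Nonempty → W x ∈ argminOn distOne {V | IsOpt α x V} := by
    intro n
    have : SigmaCompactSpace (Matrix (Fin p) (Fin p) ℝ) :=
      inferInstanceAs (SigmaCompactSpace (Fin p → Fin p → ℝ))
    exact exists_measurable_selection (fun x => {V | IsOpt α x V})
      (hitMeasurable_of_isClosed_graph (isClosed_isOpt α)) (fun x => isCompact_isOpt x α)
      continuous_distOne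
  choose W hW1 hW2 using hsel
  refine ⟨W, fun n => ⟨hW1 n, fun x hx => ?_⟩, fun n x hx => hW2 n x (exists_isOpt x α hx)⟩
  rw [covMat_empirical] at hx
  exact (hW2 n x (exists_isOpt x α hx)).1.isSymPP (by rwa [covMat_empirical])

/-! ### The population index -/

section Population

variable {p : ℕ}

/-- The population projection pursuit index of an orthogonal matrix. -/
def popIndex (α : ℝ) (γ κ : Fin p → ℝ) (U : Matrix (Fin p) (Fin p) ℝ) : ℝ :=
  α * ∑ k, (∑ j, γ j * U k j ^ 3) ^ 2 + (1 - α) * ∑ k, (∑ j, κ j * U k j ^ 4) ^ 2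

theorem row_sq_sum {U : Matrix (Fin p) (Fin p) ℝ} (hU : U * Uᵀ = 1) (k : Fin p) :
    ∑ j, U k j ^ 2 = 1 := by
  have := congrFun (congrFun hU k) k
  simpa [Matrix.mul_apply, sq] using this

theorem col_sq_sum {U : Matrix (Fin p) (Fin p) ℝ} (hU : U * Uᵀ = 1) (j : Fin p) :
    ∑ k, U k j ^ 2 = 1 := by
  have hU' : Uᵀ * U = 1 := mul_eq_one_comm.1 hU
  have := congrFun (congrFun hU' j) j
  simpa [Matrix.mul_apply, sq] using this

/-- Cauchy–Schwarz with the splittings `u · (γ u²)` and `u · (κ u³)`, where the first factor is a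
unit row. In the kurtosis part `u⁶ ≤ u⁴` is used as well. -/
theorem popIndex_le {α : ℝ} (h0 : 0 ≤ α) (h1 : α ≤ 1) (γ κ : Fin p → ℝ)
    {U : Matrix (Fin p) (Fin p) ℝ} (hU : U * Uᵀ = 1) :
    popIndex α γ κ U ≤ ∑ j, (α * γ j ^ 2 + (1 - α) * κ j ^ 2) * ∑ k, U k j ^ 4 := by
  have hle : ∀ k j, U k j ^ 2 ≤ 1 := fun k j => by
    rw [← row_sq_sum hU k]
    exact Finset.single_le_sum (f := fun j => U k j ^ 2) (fun _ _ => sq_nonneg _)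
      (Finset.mem_univ j)
  have hg : ∀ k, (∑ j, γ j * U k j ^ 3) ^ 2 ≤ ∑ j, γ j ^ 2 * U k j ^ 4 := fun k => by
    have := Finset.sum_mul_sq_le_sq_mul_sq Finset.univ (fun j => U k j)
      (fun j => γ j * U k j ^ 2)
    rw [row_sq_sum hU, one_mul] at this
    calc (∑ j, γ j * U k j ^ 3) ^ 2 = (∑ j, U k j * (γ j * U k j ^ 2)) ^ 2 := by
          congr 2; ext j; ring
      _ ≤ _ := this
      _ = _ := Finset.sum_congr rfl fun j _ => by ring
  have hk : ∀ k, (∑ j, κ j * U k j ^ 4) ^ 2 ≤ ∑ j, κ j ^ 2 * U k j ^ 4 := fun k => by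
    have := Finset.sum_mul_sq_le_sq_mul_sq Finset.univ (fun j => U k j)
      (fun j => κ j * U k j ^ 3)
    rw [row_sq_sum hU, one_mul] at this
    calc (∑ j, κ j * U k j ^ 4) ^ 2 = (∑ j, U k j * (κ j * U k j ^ 3)) ^ 2 := by
          congr 2; ext j; ring
      _ ≤ _ := this
      _ ≤ _ := Finset.sum_le_sum fun j _ => by
          calc (κ j * U k j ^ 3) ^ 2 = κ j ^ 2 * U k j ^ 4 * U k j ^ 2 := by ring
            _ ≤ κ j ^ 2 * U k j ^ 4 * 1 := mul_le_mul_of_nonneg_left (hle k j) (by positivity)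
            _ = _ := mul_one _
  calc popIndex α γ κ U ≤ α * ∑ k, ∑ j, γ j ^ 2 * U k j ^ 4 +
        (1 - α) * ∑ k, ∑ j, κ j ^ 2 * U k j ^ 4 :=
        add_le_add (mul_le_mul_of_nonneg_left (Finset.sum_le_sum fun k _ => hg k) h0)
          (mul_le_mul_of_nonneg_left (Finset.sum_le_sum fun k _ => hk k) (by linarith))
    _ = _ := by
        rw [Finset.sum_comm, Finset.sum_comm (f := fun k j => κ j ^ 2 * U k j ^ 4),
          Finset.mul_sum, Finset.mul_sum, ← Finset.sum_add_distrib]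
        refine Finset.sum_congr rfl fun j _ => ?_
        rw [← Finset.mul_sum, ← Finset.mul_sum]; ring

theorem popIndex_one (α : ℝ) (γ κ : Fin p → ℝ) :
    popIndex α γ κ 1 = ∑ j, (α * γ j ^ 2 + (1 - α) * κ j ^ 2) := by
  simp [popIndex, Matrix.one_apply, ite_pow, Finset.sum_add_distrib, Finset.mul_sum]

/-- Orthogonal matrices at which the population index is at least its value at the identity are
signed permutations. -/
theorem sq_eq_zero_or_one_of_popIndex_le {α : ℝ} (h0 : 0 ≤ α) (h1 : α ≤ 1) {γ κ : Fin p → ℝ}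
    (hc : ∀ k l, α * γ k ^ 2 + (1 - α) * κ k ^ 2 = 0 → α * γ l ^ 2 + (1 - α) * κ l ^ 2 = 0 → k = l)
    {U : Matrix (Fin p) (Fin p) ℝ} (hU : U * Uᵀ = 1)
    (h : popIndex α γ κ 1 ≤ popIndex α γ κ U) (k j : Fin p) : U k j ^ 2 = 0 ∨ U k j ^ 2 = 1 := by
  have hle : ∀ k j, U k j ^ 2 ≤ 1 := fun k j => by
    rw [← row_sq_sum hU k]
    exact Finset.single_le_sum (f := fun j => U k j ^ 2) (fun _ _ => sq_nonneg _)
      (Finset.mem_univ j)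
  have hterm : ∀ k j, 0 ≤ U k j ^ 2 - U k j ^ 4 := fun k j => by
    nlinarith [hle k j, sq_nonneg (U k j)]
  have hcn : ∀ j, 0 ≤ α * γ j ^ 2 + (1 - α) * κ j ^ 2 := fun j =>
    add_nonneg (mul_nonneg h0 (sq_nonneg _)) (mul_nonneg (by linarith) (sq_nonneg _))
  have hnn : ∀ j ∈ Finset.univ,
      0 ≤ (α * γ j ^ 2 + (1 - α) * κ j ^ 2) * ∑ k, (U k j ^ 2 - U k j ^ 4) := fun j _ =>
    mul_nonneg (hcn j) (Finset.sum_nonneg fun k _ => hterm k j)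
  -- Columns have unit norm, so this sum is the gap between the value at the identity and the upper
  -- bound at `U`. It consists of nonnegative terms, and the hypothesis leaves no gap.
  have hsum : ∑ j, (α * γ j ^ 2 + (1 - α) * κ j ^ 2) * ∑ k, (U k j ^ 2 - U k j ^ 4) = 0 := by
    refine le_antisymm ?_ (Finset.sum_nonneg hnn)
    have := h.trans (popIndex_le h0 h1 γ κ hU)
    rw [popIndex_one] at this
    simp only [Finset.sum_sub_distrib, col_sq_sum hU, mul_sub, mul_one]
    linarith
  have hz : ∀ j, α * γ j ^ 2 + (1 - α) * κ j ^ 2 ≠ 0 → ∀ k, U k j ^ 2 = 0 ∨ U k j ^ 2 = 1 := by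
    intro j hj k
    have h2 := (mul_eq_zero.1 ((Finset.sum_eq_zero_iff_of_nonneg hnn).1 hsum j
      (Finset.mem_univ j))).resolve_left hj
    have h3 := (Finset.sum_eq_zero_iff_of_nonneg fun k _ => hterm k j).1 h2 k (Finset.mem_univ k)
    have h4 : U k j ^ 2 * (1 - U k j ^ 2) = 0 := by linear_combination h3
    rcases mul_eq_zero.1 h4 with h5 | h5
    · exact Or.inl h5
    · exact Or.inr (by linarith)
  -- The one column that may have zero coefficient is not controlled by the sum. Its entry in row
  -- `k` is determined by the other entries of that unit row, all of which have square `0` or `1`.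
  by_cases hj : α * γ j ^ 2 + (1 - α) * κ j ^ 2 = 0
  · have hrow := row_sq_sum hU k
    rw [← Finset.add_sum_erase _ _ (Finset.mem_univ j)] at hrow
    by_cases he : ∃ i, i ≠ j ∧ U k i ^ 2 = 1
    · obtain ⟨i, hij, hi⟩ := he
      left
      have : U k i ^ 2 ≤ ∑ i ∈ Finset.univ.erase j, U k i ^ 2 :=
        Finset.single_le_sum (f := fun j => U k j ^ 2) (fun _ _ => sq_nonneg _)
          (Finset.mem_erase.2 ⟨hij, Finset.mem_univ i⟩)
      nlinarith [sq_nonneg (U k j)]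
    · right
      push Not at he
      rw [Finset.sum_eq_zero, add_zero] at hrow
      · exact hrow
      · intro i hi
        have hij := (Finset.mem_erase.1 hi).1
        exact (hz i (fun h' => hij (hc i j h' hj)) k).resolve_right (he i hij)
  · exact hz j hj k

end Population

/-! ### Moments of vectors with independent standardized components -/

section Moments

variable {Ω : Type*} [MeasurableSpace Ω] {P : Measure Ω} {p : ℕ}

/-- Setting coordinate `a` to zero encodes the remaining components as a vector of the same type,
which allows functions of them to be written without a subtype index. -/
theorem indepFun_update {Z : Ω → Fin p → ℝ} (hZ : Measurable Z)
    (hcomp : iIndepFun (fun k ω => Z ω k) P) (a : Fin p) :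
    IndepFun (fun ω => Z ω a) (fun ω => Function.update (Z ω) a 0) P := by
  have h := hcomp.indepFun_finset {a} {a}ᶜ (by simp)
    (fun k => (measurable_pi_apply k).comp hZ)
  have h1 : Measurable fun r : ({a} : Finset (Fin p)) → ℝ => r ⟨a, by simp⟩ :=
    measurable_pi_apply _
  have h2 : Measurable fun (r : (({a}ᶜ : Finset (Fin p)) → ℝ)) (j : Fin p) =>
      if hj : j ∈ ({a}ᶜ : Finset (Fin p)) then r ⟨j, hj⟩ else 0 := by
    refine measurable_pi_lambda _ fun j => ?_
    by_cases hj : j ∈ ({a}ᶜ : Finset (Fin p))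
    · simp only [hj, dite_true]; exact measurable_pi_apply _
    · simp only [hj, dite_false]; exact measurable_const
  have h3 := h.comp h1 h2
  have e : (fun ω => Function.update (Z ω) a 0) =
      (fun (r : (({a}ᶜ : Finset (Fin p)) → ℝ)) (j : Fin p) =>
        if hj : j ∈ ({a}ᶜ : Finset (Fin p)) then r ⟨j, hj⟩ else 0) ∘
          fun ω (i : (({a}ᶜ : Finset (Fin p)))) => Z ω i := by
    ext ω j
    by_cases hj : j = a <;> simp [hj]
  rw [e]
  exact h3

/-- A random vector with measurable, independent, standardized components with finite sixth
moments. -/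
structure IsStandard (P : Measure Ω) (Z : Ω → Fin p → ℝ) : Prop where
  meas : Measurable Z
  indep : iIndepFun (fun k ω => Z ω k) P
  mean : ∀ k, ∫ ω, Z ω k ∂P = 0
  var : ∀ k, ∫ ω, Z ω k ^ 2 ∂P = 1
  mem : ∀ k, MemLp (fun ω => Z ω k) 6 P

variable {Z : Ω → Fin p → ℝ}

theorem IsStandard.integral_mul_update (h : IsStandard P Z) (a : Fin p) {φ : ℝ → ℝ}
    {ψ : (Fin p → ℝ) → ℝ} (hφ : Measurable φ) (hψ : Measurable ψ) :
    ∫ ω, φ (Z ω a) * ψ (Function.update (Z ω) a 0) ∂P =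
      (∫ ω, φ (Z ω a) ∂P) * ∫ ω, ψ (Function.update (Z ω) a 0) ∂P := by
  have hu : Measurable fun ω => Function.update (Z ω) a 0 :=
    (measurable_update' (a := a)).comp (h.meas.prodMk measurable_const)
  have ha : Measurable fun ω => Z ω a := (measurable_pi_apply a).comp h.meas
  exact ((indepFun_update h.meas h.indep a).comp hφ hψ).integral_fun_mul_eq_mul_integral
    (hφ.comp ha).aestronglyMeasurable (hψ.comp hu).aestronglyMeasurable

/-- A component that enters a product once, independently of the rest, contributes its zero mean.
This kills all mixed moments with an isolated index. -/
theorem IsStandard.integral_isolated (h : IsStandard P Z) (a : Fin p)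
    {ψ : (Fin p → ℝ) → ℝ} (hψ : Measurable ψ) :
    ∫ ω, Z ω a * ψ (Function.update (Z ω) a 0) ∂P = 0 := by
  have := h.integral_mul_update a measurable_id hψ
  simp only [id] at this
  rw [this, h.mean, zero_mul]

theorem IsStandard.integral_isolated_three (h : IsStandard P Z) {a b c d : Fin p} (hb : b ≠ a)
    (hc : c ≠ a) (hd : d ≠ a) : ∫ ω, Z ω a * (Z ω b * Z ω c * Z ω d) ∂P = 0 := by
  have := h.integral_isolated a (ψ := fun y => y b * y c * y d) (by fun_prop)
  simpa [Function.update_of_ne, hb, hc, hd] using this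

theorem IsStandard.integral_isolated_two (h : IsStandard P Z) {a b c : Fin p} (hb : b ≠ a)
    (hc : c ≠ a) : ∫ ω, Z ω a * (Z ω b * Z ω c) ∂P = 0 := by
  have := h.integral_isolated a (ψ := fun y => y b * y c) (by fun_prop)
  simpa [Function.update_of_ne, hb, hc] using this

theorem IsStandard.integral_sq_mul_sq (h : IsStandard P Z) {a b : Fin p} (hb : b ≠ a) :
    ∫ ω, Z ω a ^ 2 * Z ω b ^ 2 ∂P = 1 := by
  have := h.integral_mul_update a (φ := fun y => y ^ 2) (ψ := fun y => y b ^ 2) (by fun_prop)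
    (by fun_prop)
  simpa [Function.update_of_ne, hb, h.var] using this

theorem IsStandard.integral_two (h : IsStandard P Z) (a b : Fin p) :
    ∫ ω, Z ω a * Z ω b ∂P = if a = b then 1 else 0 := by
  split_ifs with hab
  · subst hab
    rw [← h.var a]; congr 1; ext ω; ring
  · have := h.integral_isolated a (ψ := fun y => y b) (by fun_prop)
    simpa [Function.update_of_ne (Ne.symm hab)] using this

theorem IsStandard.integral_three (h : IsStandard P Z) (a b c : Fin p) :
    ∫ ω, Z ω a * Z ω b * Z ω c ∂P =
      (if a = b then 1 else 0) * (if a = c then 1 else 0) * gam P Z a := by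
  by_cases hab : a = b
  · subst hab
    by_cases hac : a = c
    · subst hac
      simp only [if_true, one_mul, gam]
      congr 1; ext ω; ring
    · rw [if_neg hac, mul_zero, zero_mul, ← h.integral_isolated_two (a := c) hac hac]
      congr 1; ext ω; ring
  · rw [if_neg hab, zero_mul, zero_mul]
    by_cases hac : a = c
    · subst hac
      rw [← h.integral_isolated_two (a := b) hab hab]
      congr 1; ext ω; ring
    · rw [← h.integral_isolated_two (a := a) (Ne.symm hab) (Ne.symm hac)]
      congr 1; ext ω; ring

/-- The three Gaussian pairings plus the fourth cumulant on the full diagonal. Every index pattern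
has an isolated index, is two distinct pairs, or is constant; in the last case the pairings give `3`
and the cumulant restores the fourth moment. -/
theorem IsStandard.integral_four (h : IsStandard P Z) (a b c d : Fin p) :
    ∫ ω, Z ω a * Z ω b * Z ω c * Z ω d ∂P =
      (if a = b then 1 else 0) * (if c = d then 1 else 0) +
      (if a = c then 1 else 0) * (if b = d then 1 else 0) +
      (if a = d then 1 else 0) * (if b = c then 1 else 0) +
      (if a = b then 1 else 0) * (if a = c then 1 else 0) * (if a = d then 1 else 0) *
        kap P Z a := by
  by_cases hab : a = b
  · subst hab
    by_cases hcd : c = d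
    · subst hcd
      by_cases hac : a = c
      · subst hac
        simp only [if_true, one_mul, kap, bet]
        rw [show (1 : ℝ) + 1 + 1 + (∫ ω, Z ω a ^ 4 ∂P - 3) = ∫ ω, Z ω a ^ 4 ∂P by ring]
        congr 1; ext ω; ring
      · simp only [if_true, if_neg hac, mul_zero, zero_mul, add_zero, mul_one]
        rw [← h.integral_sq_mul_sq (Ne.symm hac)]
        congr 1; ext ω; ring
    · by_cases hac : a = c
      · subst hac
        simp only [if_true, if_neg hcd, mul_zero, zero_mul, add_zero]
        rw [← h.integral_isolated_three (a := d) hcd hcd hcd]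
        congr 1; ext ω; ring
      · simp only [if_true, if_neg hcd, if_neg hac, mul_zero, zero_mul, add_zero]
        rw [← h.integral_isolated_three (a := c) hac hac (Ne.symm hcd)]
        congr 1; ext ω; ring
  · by_cases hac : a = c
    · subst hac
      by_cases hbd : b = d
      · subst hbd
        simp only [if_true, if_neg hab, mul_zero, zero_mul, add_zero, zero_add, mul_one]
        rw [← h.integral_sq_mul_sq (Ne.symm hab)]
        congr 1; ext ω; ring
      · simp only [if_true, if_neg hab, if_neg hbd, if_neg (Ne.symm hab), mul_zero, zero_mul,
          add_zero]
        rw [← h.integral_isolated_three (a := b) hab hab (Ne.symm hbd)]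
        congr 1; ext ω; ring
    · by_cases had : a = d
      · subst had
        by_cases hbc : b = c
        · subst hbc
          simp only [if_true, if_neg hab, mul_zero, zero_mul, add_zero, zero_add, mul_one]
          rw [← h.integral_sq_mul_sq (Ne.symm hab)]
          congr 1; ext ω; ring
        · simp only [if_neg hab, if_neg hac, if_neg hbc, mul_zero, zero_mul, add_zero]
          rw [← h.integral_isolated_three (a := b) hab (Ne.symm hbc) hab]
          congr 1; ext ω; ring
      · simp only [if_neg hab, if_neg hac, if_neg had, zero_mul, add_zero]
        rw [← h.integral_isolated_three (Ne.symm hab) (Ne.symm hac) (Ne.symm had)]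
        congr 1; ext ω; ring

/-! ### Multilinear expansions -/

theorem dotProduct_mul_two {ι : Type*} [Fintype ι] (u v z : ι → ℝ) :
    (u ⬝ᵥ z) * (v ⬝ᵥ z) = ∑ a, ∑ b, (u a * v b) * (z a * z b) := by
  simp only [dotProduct, Finset.sum_mul_sum]
  exact Finset.sum_congr rfl fun a _ => Finset.sum_congr rfl fun b _ => by ring

theorem dotProduct_mul_three {ι : Type*} [Fintype ι] (u v w z : ι → ℝ) :
    (u ⬝ᵥ z) * (v ⬝ᵥ z) * (w ⬝ᵥ z) =
      ∑ a, ∑ b, ∑ c, (u a * v b * w c) * (z a * z b * z c) := by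
  rw [dotProduct_mul_two, Finset.sum_mul]
  refine Finset.sum_congr rfl fun a _ => ?_
  rw [Finset.sum_mul]
  refine Finset.sum_congr rfl fun b _ => ?_
  rw [dotProduct, Finset.mul_sum]
  exact Finset.sum_congr rfl fun c _ => by ring

theorem dotProduct_mul_four {ι : Type*} [Fintype ι] (u v w t z : ι → ℝ) :
    (u ⬝ᵥ z) * (v ⬝ᵥ z) * (w ⬝ᵥ z) * (t ⬝ᵥ z) =
      ∑ a, ∑ b, ∑ c, ∑ d, (u a * v b * w c * t d) * (z a * z b * z c * z d) := by
  rw [dotProduct_mul_three, Finset.sum_mul]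
  refine Finset.sum_congr rfl fun a _ => ?_
  rw [Finset.sum_mul]
  refine Finset.sum_congr rfl fun b _ => ?_
  rw [Finset.sum_mul]
  refine Finset.sum_congr rfl fun c _ => ?_
  rw [dotProduct, Finset.mul_sum]
  exact Finset.sum_congr rfl fun d _ => by ring

/-- Hölder twice: products of two functions in `L⁴` are in `L²`, and a product of two of those is
integrable. -/
theorem integrable_mul_four {f g h k : Ω → ℝ} (hf : MemLp f 4 P) (hg : MemLp g 4 P)
    (hh : MemLp h 4 P) (hk : MemLp k 4 P) : Integrable (fun ω => f ω * g ω * h ω * k ω) P := by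
  have : ENNReal.HolderTriple 4 4 2 := ⟨by
    rw [← two_mul, show (4 : ℝ≥0∞) = 2 * 2 by norm_num, ENNReal.mul_inv (by simp) (by simp),
      ← mul_assoc, ENNReal.mul_inv_cancel (by simp) (by simp), one_mul]⟩
  have h1 : MemLp (f * g) 2 P := hg.mul hf
  have h2 : MemLp (h * k) 2 P := hk.mul hh
  have h3 := h1.integrable_mul h2
  refine h3.congr (ae_of_all _ fun ω => ?_)
  simp only [Pi.mul_apply]; ring

variable [IsProbabilityMeasure P]

theorem IsStandard.mem_four (h : IsStandard P Z) (k : Fin p) : MemLp (fun ω => Z ω k) 4 P :=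
  (h.mem k).mono_exponent (by norm_num)

theorem IsStandard.integral_dot_two (h : IsStandard P Z) (u v : Fin p → ℝ) :
    ∫ ω, (u ⬝ᵥ Z ω) * (v ⬝ᵥ Z ω) ∂P = u ⬝ᵥ v := by
  have h1 : MemLp (fun _ : Ω => (1 : ℝ)) 4 P := memLp_const 1
  have hi : ∀ a b, Integrable (fun ω => Z ω a * Z ω b) P := fun a b => by
    simpa using integrable_mul_four (h.mem_four a) (h.mem_four b) h1 h1
  simp only [dotProduct_mul_two]
  rw [integral_finsetSum _ fun a _ => integrable_finsetSum _ fun b _ => (hi a b).const_mul _]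
  simp only [integral_finsetSum _ fun b _ => (hi _ b).const_mul _, integral_const_mul,
    h.integral_two, dotProduct]
  simp

theorem IsStandard.integral_dot_three (h : IsStandard P Z) (u v w : Fin p → ℝ) :
    ∫ ω, (u ⬝ᵥ Z ω) * (v ⬝ᵥ Z ω) * (w ⬝ᵥ Z ω) ∂P = ∑ j, gam P Z j * (u j * v j * w j) := by
  have h1 : MemLp (fun _ : Ω => (1 : ℝ)) 4 P := memLp_const 1
  have hi : ∀ a b c, Integrable (fun ω => Z ω a * Z ω b * Z ω c) P := fun a b c => by
    simpa using integrable_mul_four (h.mem_four a) (h.mem_four b) (h.mem_four c) h1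
  simp only [dotProduct_mul_three]
  rw [integral_finsetSum _ fun a _ => integrable_finsetSum _ fun b _ =>
    integrable_finsetSum _ fun c _ => (hi a b c).const_mul _]
  refine Finset.sum_congr rfl fun a _ => ?_
  rw [integral_finsetSum _ fun b _ => integrable_finsetSum _ fun c _ => (hi a b c).const_mul _]
  simp only [integral_finsetSum _ fun b _ => (hi _ _ b).const_mul _, integral_const_mul,
    h.integral_three]
  simp
  ring

theorem IsStandard.integral_dot_four (h : IsStandard P Z) (u v w t : Fin p → ℝ) :
    ∫ ω, (u ⬝ᵥ Z ω) * (v ⬝ᵥ Z ω) * (w ⬝ᵥ Z ω) * (t ⬝ᵥ Z ω) ∂P =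
      (u ⬝ᵥ v) * (w ⬝ᵥ t) + (u ⬝ᵥ w) * (v ⬝ᵥ t) + (u ⬝ᵥ t) * (v ⬝ᵥ w) +
        ∑ j, kap P Z j * (u j * v j * w j * t j) := by
  have hi : ∀ a b c d, Integrable (fun ω => Z ω a * Z ω b * Z ω c * Z ω d) P := fun a b c d =>
    integrable_mul_four (h.mem_four a) (h.mem_four b) (h.mem_four c) (h.mem_four d)
  simp only [dotProduct_mul_four]
  rw [integral_finsetSum _ fun a _ => integrable_finsetSum _ fun b _ =>
    integrable_finsetSum _ fun c _ => integrable_finsetSum _ fun d _ => (hi a b c d).const_mul _]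
  simp only [dotProduct, Finset.sum_mul, ← Finset.sum_add_distrib]
  refine Finset.sum_congr rfl fun a _ => ?_
  rw [integral_finsetSum _ fun b _ => integrable_finsetSum _ fun c _ =>
    integrable_finsetSum _ fun d _ => (hi a b c d).const_mul _]
  simp only [integral_finsetSum _ fun c _ => integrable_finsetSum _ fun d _ =>
    (hi _ _ c d).const_mul _, integral_finsetSum _ fun d _ => (hi _ _ _ d).const_mul _,
    integral_const_mul, h.integral_four, mul_add, Finset.sum_add_distrib]
  simp [Finset.mul_sum]
  simp only [mul_comm, mul_left_comm, mul_assoc]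

end Moments

/-! ### Convergence of sample moments along a sample path -/

section Path

variable {Ω : Type*} [MeasurableSpace Ω] {P : Measure Ω} {p : ℕ} {Z : Ω → Fin p → ℝ}

/-- The vector `(1, y)`. -/
def aug (y : Fin p → ℝ) : Option (Fin p) → ℝ := fun a => a.elim 1 y

/-- Coefficients in `(1, y)` of the linear form `w` centered at `m`. -/
def augCoef (w m : Fin p → ℝ) : Option (Fin p) → ℝ := fun a => a.elim (-(w ⬝ᵥ m)) w

/-- Coefficients in `(1, y)` of the constant `1`. -/
def augOne : Option (Fin p) → ℝ := fun a => a.elim 1 0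

theorem augCoef_dot (w m y : Fin p → ℝ) : augCoef w m ⬝ᵥ aug y = w ⬝ᵥ (y - m) := by
  rw [dotProduct_sub, dotProduct, Fintype.sum_option]
  simp [augCoef, aug, dotProduct]
  ring

theorem augOne_dot (y : Fin p → ℝ) : augOne ⬝ᵥ aug y = 1 := by
  rw [dotProduct, Fintype.sum_option]
  simp [augOne, aug]

/-- The first `n` points of a sequence. -/
def firstPoints (x : ℕ → Fin p → ℝ) (n : ℕ) : Fin n → Fin p → ℝ := fun i => x i

/-- Sample moments up to order four converge to those of `Z`. -/
def MomentsConverge (P : Measure Ω) (Z : Ω → Fin p → ℝ) (x : ℕ → Fin p → ℝ) : Prop :=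
  ∀ a b c d : Option (Fin p),
    Tendsto (fun n => emean (firstPoints x n) fun y => aug y a * aug y b * aug y c * aug y d) atTop
      (𝓝 (∫ ω, aug (Z ω) a * aug (Z ω) b * aug (Z ω) c * aug (Z ω) d ∂P))

theorem memLp_aug [IsProbabilityMeasure P] (hZ : ∀ k, MemLp (fun ω => Z ω k) 4 P)
    (a : Option (Fin p)) : MemLp (fun ω => aug (Z ω) a) 4 P := by
  cases a with
  | none => exact memLp_const 1
  | some k => exact hZ k

/-- Multilinearity writes the sample moment as a finite sum of converging coefficients times fixed
sample moments. The filter `L` is arbitrary below `atTop` so that the result applies along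
ultrafilters. -/
theorem MomentsConverge.tendsto_prod [IsProbabilityMeasure P] {x : ℕ → Fin p → ℝ}
    (hx : MomentsConverge P Z x) (hZ : ∀ k, MemLp (fun ω => Z ω k) 4 P) {L : Filter ℕ}
    (hL : L ≤ atTop) {u v w t : ℕ → Option (Fin p) → ℝ} {u₀ v₀ w₀ t₀ : Option (Fin p) → ℝ}
    (hu : Tendsto u L (𝓝 u₀)) (hv : Tendsto v L (𝓝 v₀)) (hw : Tendsto w L (𝓝 w₀))
    (ht : Tendsto t L (𝓝 t₀)) :
    Tendsto (fun n => emean (firstPoints x n) fun y =>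
      (u n ⬝ᵥ aug y) * (v n ⬝ᵥ aug y) * (w n ⬝ᵥ aug y) * (t n ⬝ᵥ aug y)) L
      (𝓝 (∫ ω, (u₀ ⬝ᵥ aug (Z ω)) * (v₀ ⬝ᵥ aug (Z ω)) * (w₀ ⬝ᵥ aug (Z ω)) *
        (t₀ ⬝ᵥ aug (Z ω)) ∂P)) := by
  have hi : ∀ a b c d, Integrable (fun ω => aug (Z ω) a * aug (Z ω) b * aug (Z ω) c *
      aug (Z ω) d) P := fun a b c d =>
    integrable_mul_four (memLp_aug hZ a) (memLp_aug hZ b) (memLp_aug hZ c) (memLp_aug hZ d)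
  have e : ∫ ω, (u₀ ⬝ᵥ aug (Z ω)) * (v₀ ⬝ᵥ aug (Z ω)) * (w₀ ⬝ᵥ aug (Z ω)) *
        (t₀ ⬝ᵥ aug (Z ω)) ∂P = ∑ a, ∑ b, ∑ c, ∑ d, (u₀ a * v₀ b * w₀ c * t₀ d) *
          ∫ ω, aug (Z ω) a * aug (Z ω) b * aug (Z ω) c * aug (Z ω) d ∂P := by
    simp only [dotProduct_mul_four]
    rw [integral_finsetSum _ fun a _ => integrable_finsetSum _ fun b _ =>
      integrable_finsetSum _ fun c _ => integrable_finsetSum _ fun d _ => (hi a b c d).const_mul _]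
    refine Finset.sum_congr rfl fun a _ => ?_
    rw [integral_finsetSum _ fun b _ => integrable_finsetSum _ fun c _ =>
      integrable_finsetSum _ fun d _ => (hi a b c d).const_mul _]
    simp only [integral_finsetSum _ fun c _ => integrable_finsetSum _ fun d _ =>
      (hi _ _ c d).const_mul _, integral_finsetSum _ fun d _ => (hi _ _ _ d).const_mul _,
      integral_const_mul]
  rw [e]
  simp only [dotProduct_mul_four, emean_sum, emean_const_mul]
  refine tendsto_finsetSum _ fun a _ => tendsto_finsetSum _ fun b _ =>
    tendsto_finsetSum _ fun c _ => tendsto_finsetSum _ fun d _ => ?_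
  exact ((((tendsto_pi_nhds.1 hu a).mul (tendsto_pi_nhds.1 hv b)).mul
    (tendsto_pi_nhds.1 hw c)).mul (tendsto_pi_nhds.1 ht d)).mul ((hx a b c d).mono_left hL)

/-- Centered sample moments of converging linear forms converge to the moments of a standardized
vector with third moments `γ` and excess kurtoses `κ`. -/
structure CenteredMomentsConverge (γ κ : Fin p → ℝ) (x : ℕ → Fin p → ℝ) : Prop where
  xbar : ∀ k, Tendsto (fun n => xbar (firstPoints x n) k) atTop (𝓝 0)
  two : ∀ {L : Filter ℕ}, L ≤ atTop → ∀ {u v : ℕ → Fin p → ℝ} {u₀ v₀ : Fin p → ℝ},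
    Tendsto u L (𝓝 u₀) → Tendsto v L (𝓝 v₀) →
    Tendsto (fun n => c2 (firstPoints x n) (u n) (v n)) L (𝓝 (u₀ ⬝ᵥ v₀))
  three : ∀ {L : Filter ℕ}, L ≤ atTop → ∀ {u v w : ℕ → Fin p → ℝ} {u₀ v₀ w₀ : Fin p → ℝ},
    Tendsto u L (𝓝 u₀) → Tendsto v L (𝓝 v₀) → Tendsto w L (𝓝 w₀) →
    Tendsto (fun n => c3 (firstPoints x n) (u n) (v n) (w n)) L
      (𝓝 (∑ j, γ j * (u₀ j * v₀ j * w₀ j)))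
  four : ∀ {L : Filter ℕ}, L ≤ atTop →
    ∀ {u v w t : ℕ → Fin p → ℝ} {u₀ v₀ w₀ t₀ : Fin p → ℝ},
    Tendsto u L (𝓝 u₀) → Tendsto v L (𝓝 v₀) → Tendsto w L (𝓝 w₀) → Tendsto t L (𝓝 t₀) →
    Tendsto (fun n => c4 (firstPoints x n) (u n) (v n) (w n) (t n)) L
      (𝓝 ((u₀ ⬝ᵥ v₀) * (w₀ ⬝ᵥ t₀) + (u₀ ⬝ᵥ w₀) * (v₀ ⬝ᵥ t₀) + (u₀ ⬝ᵥ t₀) * (v₀ ⬝ᵥ w₀) +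
        ∑ j, κ j * (u₀ j * v₀ j * w₀ j * t₀ j)))

/-- Centering at the sample mean only adds a constant coefficient that tends to zero. Moments of
order two and three are fourth-order ones padded with the constant form `augOne`. -/
theorem MomentsConverge.centered [IsProbabilityMeasure P] (hZ : IsStandard P Z)
    {x : ℕ → Fin p → ℝ} (hx : MomentsConverge P Z x) :
    CenteredMomentsConverge (gam P Z) (kap P Z) x := by
  have h4 := hZ.mem_four
  have hb : ∀ k, Tendsto (fun n => SymPP.xbar (firstPoints x n) k) atTop (𝓝 0) := fun k => by
    have := hx (some k) none none none
    simpa [aug, hZ.mean, SymPP.xbar] using this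
  have hc : ∀ {L : Filter ℕ}, L ≤ atTop → ∀ {u : ℕ → Fin p → ℝ} {u₀ : Fin p → ℝ},
      Tendsto u L (𝓝 u₀) →
      Tendsto (fun n => augCoef (u n) (SymPP.xbar (firstPoints x n))) L (𝓝 (augCoef u₀ 0)) := by
    intro L hL u u₀ hu
    refine tendsto_pi_nhds.2 fun a => ?_
    cases a with
    | none =>
      simp only [augCoef, Option.elim, dotProduct]
      refine (tendsto_finsetSum _ fun j _ => ?_).neg
      exact (tendsto_pi_nhds.1 hu j).mul ((hb j).mono_left hL)
    | some k => exact tendsto_pi_nhds.1 hu k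
  have h1 : ∀ L : Filter ℕ, Tendsto (fun _ : ℕ => (augOne : Option (Fin p) → ℝ)) L (𝓝 augOne) :=
    fun L => tendsto_const_nhds
  refine ⟨hb, ?_, ?_, ?_⟩
  · intro L hL u v u₀ v₀ hu hv
    unfold c2
    have := hx.tendsto_prod h4 hL (hc hL hu) (hc hL hv) (h1 L) (h1 L)
    simpa only [augCoef_dot, augOne_dot, mul_one, sub_zero, hZ.integral_dot_two] using this
  · intro L hL u v w u₀ v₀ w₀ hu hv hw
    unfold c3
    have := hx.tendsto_prod h4 hL (hc hL hu) (hc hL hv) (hc hL hw) (h1 L)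
    simpa only [augCoef_dot, augOne_dot, mul_one, sub_zero, hZ.integral_dot_three] using this
  · intro L hL u v w t u₀ v₀ w₀ t₀ hu hv hw ht
    unfold c4
    have := hx.tendsto_prod h4 hL (hc hL hu) (hc hL hv) (hc hL hw) (hc hL ht)
    simpa only [augCoef_dot, augOne_dot, mul_one, sub_zero, hZ.integral_dot_four] using this

theorem ae_momentsConverge [IsProbabilityMeasure P] {z : ℕ → Ω → Fin p → ℝ}
    (hindep : iIndepFun z P) (hident : ∀ i, IdentDistrib (z i) (z 0) P P)
    (h4 : ∀ k, MemLp (fun ω => z 0 ω k) 4 P) :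
    ∀ᵐ ω ∂P, MomentsConverge P (z 0) fun i => z i ω := by
  have haug : ∀ a, Measurable fun y : Fin p → ℝ => aug y a := fun a => by
    cases a with
    | none => exact measurable_const
    | some k => exact measurable_pi_apply k
  simp only [MomentsConverge, ae_all_iff]
  intro a b c d
  have hm : Measurable fun y : Fin p → ℝ => aug y a * aug y b * aug y c * aug y d :=
    (((haug a).mul (haug b)).mul (haug c)).mul (haug d)
  have := strong_law_ae_real
    (fun i ω => aug (z i ω) a * aug (z i ω) b * aug (z i ω) c * aug (z i ω) d)
    (integrable_mul_four (memLp_aug h4 a) (memLp_aug h4 b) (memLp_aug h4 c) (memLp_aug h4 d))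
    (fun i j hij => (hindep.indepFun hij).comp hm hm) (fun i => (hident i).comp hm)
  filter_upwards [this] with ω hω
  refine hω.congr fun n => ?_
  rw [div_eq_inv_mul, emean, ← Fin.sum_univ_eq_sum_range
    (fun i => aug (z i ω) a * aug (z i ω) b * aug (z i ω) c * aug (z i ω) d)]
  rfl

end Path

/-! ### Consistency -/

section Consistency

variable {p : ℕ}

/-- Each row of `Q * W` is plus or minus a row of `W`, and the summands of the index are even in the
row. Weighting by `Q k j ^ 2` expresses the permutation, and the unit columns of `Q` reassemble the
sum. -/
theorem index_signedPermutation_mul {n : ℕ} (α : ℝ) (x : Fin n → Fin p → ℝ)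
    {Q : Matrix (Fin p) (Fin p) ℝ} (hQ : Q * Qᵀ = 1) (h : ∀ k j, Q k j ^ 2 = 0 ∨ Q k j ^ 2 = 1)
    (W : Matrix (Fin p) (Fin p) ℝ) : index α x (Q * W) = index α x W := by
  have hrow : ∀ k, ∃ j, (Q k j = 1 ∨ Q k j = -1) ∧ ∀ i, i ≠ j → Q k i = 0 := by
    intro k
    have h1 := row_sq_sum hQ k
    have : ∃ j, Q k j ^ 2 = 1 := by
      by_contra! hne
      rw [Finset.sum_eq_zero fun j _ => (h k j).resolve_right (hne j)] at h1
      exact zero_ne_one h1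
    obtain ⟨j, hj⟩ := this
    refine ⟨j, by simpa using hj, fun i hi => ?_⟩
    rw [← Finset.add_sum_erase _ _ (Finset.mem_univ j), hj, add_eq_left,
      Finset.sum_eq_zero_iff_of_nonneg fun _ _ => sq_nonneg _] at h1
    exact pow_eq_zero_iff two_ne_zero |>.1 (h1 i (Finset.mem_erase.2 ⟨hi, Finset.mem_univ i⟩))
  have key : ∀ f : (Fin p → ℝ) → ℝ, (∀ w, f (-w) = f w) →
      ∑ k, f ((Q * W) k) = ∑ k, f (W k) := by
    intro f hf
    have h2 : ∀ k, f ((Q * W) k) = ∑ j, Q k j ^ 2 * f (W j) := by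
      intro k
      obtain ⟨j, hj, h0⟩ := hrow k
      have hr : (Q * W) k = Q k j • W j := by
        ext l
        rw [Matrix.mul_apply, Finset.sum_eq_single j]
        · rfl
        · intro i _ hi; rw [h0 i hi, zero_mul]
        · simp
      rw [hr, Finset.sum_eq_single j]
      · rcases hj with hj | hj <;> simp [hj, hf]
      · intro i _ hi; rw [h0 i hi]; ring
      · simp
    simp only [h2]
    rw [Finset.sum_comm]
    exact Finset.sum_congr rfl fun j _ => by rw [← Finset.sum_mul, col_sq_sum hQ, one_mul]
  rw [index, index, key (fun w => c3 x w w w ^ 2), key (fun w => (c4 x w w w w - 3) ^ 2)]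
  · intro w
    simp only [c4, neg_dotProduct, mul_neg, neg_mul, neg_neg]
  · intro w
    have : c3 x (-w) (-w) (-w) = - c3 x w w w := by
      simp only [c3, emean, neg_dotProduct, mul_neg, neg_mul, neg_neg, Finset.sum_neg_distrib]
    rw [this, neg_sq]

variable {γ κ : Fin p → ℝ} {x : ℕ → Fin p → ℝ}

theorem one_row (k : Fin p) :
    ((1 : Matrix (Fin p) (Fin p) ℝ) k : Fin p → ℝ) = Pi.single k 1 := by
  ext l
  rw [Matrix.one_apply, Pi.single_apply]
  simp [eq_comm]

theorem scov_apply {n : ℕ} (x : Fin n → Fin p → ℝ) (k l : Fin p) :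
    scov x k l = c2 x (Pi.single k 1) (Pi.single l 1) := by
  simp [scov, c2]

theorem CenteredMomentsConverge.tendsto_scov (hx : CenteredMomentsConverge γ κ x) (k l : Fin p) :
    Tendsto (fun n => scov (firstPoints x n) k l) atTop (𝓝 (if k = l then 1 else 0)) := by
  have := hx.two le_rfl (tendsto_const_nhds (x := (Pi.single k 1 : Fin p → ℝ)))
    (tendsto_const_nhds (x := (Pi.single l 1 : Fin p → ℝ)))
  simpa [← scov_apply, Pi.single_apply, eq_comm] using this

theorem c2_eq_sum_scov {n : ℕ} (x : Fin n → Fin p → ℝ) (v : Fin p → ℝ) :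
    c2 x v v = ∑ k, ∑ l, v k * v l * scov x k l := by
  simp only [c2, dotProduct_mul_two, emean_sum, emean_const_mul, scov, Matrix.of_apply,
    Pi.sub_apply]

/-- Entrywise errors of size `ε` change the quadratic form by at most `ε (∑|vₖ|)²`, hence by at most
`ε p ∑ vₖ²`. -/
theorem half_sum_sq_le_c2 {n : ℕ} {x : Fin n → Fin p → ℝ} {ε : ℝ} (hε : ε * p ≤ 1 / 2)
    (h : ∀ k l, |scov x k l - if k = l then 1 else 0| ≤ ε) (v : Fin p → ℝ) :
    1 / 2 * ∑ k, v k ^ 2 ≤ c2 x v v := by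
  have h1 : c2 x v v = ∑ k, v k ^ 2 +
      ∑ k, ∑ l, v k * v l * (scov x k l - if k = l then 1 else 0) := by
    rw [c2_eq_sum_scov]
    simp only [mul_sub, Finset.sum_sub_distrib]
    simp [sq]
  have h2 : |∑ k, ∑ l, v k * v l * (scov x k l - if k = l then 1 else 0)| ≤
      ε * (∑ k, |v k|) ^ 2 := by
    rw [sq, Finset.sum_mul_sum, Finset.mul_sum]
    refine (Finset.abs_sum_le_sum_abs _ _).trans (Finset.sum_le_sum fun k _ => ?_)
    rw [Finset.mul_sum]
    refine (Finset.abs_sum_le_sum_abs _ _).trans (Finset.sum_le_sum fun l _ => ?_)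
    rw [abs_mul, abs_mul, mul_comm ε]
    exact mul_le_mul_of_nonneg_left (h k l) (by positivity)
  rcases isEmpty_or_nonempty (Fin p) with he | ⟨⟨k₀⟩⟩
  · rw [h1]; simp
  have h0 : 0 ≤ ε := (abs_nonneg _).trans (h k₀ k₀)
  have h3 : (∑ k, |v k|) ^ 2 ≤ p * ∑ k, v k ^ 2 := by
    have := sq_sum_le_card_mul_sum_sq (s := Finset.univ) (f := fun k => |v k|)
    simpa using this
  have h4 : 0 ≤ ∑ k, v k ^ 2 := Finset.sum_nonneg fun _ _ => sq_nonneg _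
  have h5 := mul_le_mul_of_nonneg_left h3 h0
  have h6 := mul_le_mul_of_nonneg_right hε h4
  have h7 := neg_le_of_abs_le h2
  rw [h1]
  nlinarith

/-- The bound is uniform in `v`. It yields both nonsingularity of the sample covariance and
boundedness of whitening matrices. -/
theorem CenteredMomentsConverge.eventually_half_le (hx : CenteredMomentsConverge γ κ x) :
    ∀ᶠ n in atTop, ∀ v : Fin p → ℝ, 1 / 2 * ∑ k, v k ^ 2 ≤ c2 (firstPoints x n) v v := by
  have hp : (0 : ℝ) < 1 / (2 * (p + 1)) := by positivity
  have : ∀ᶠ n in atTop, ∀ k l, |scov (firstPoints x n) k l - if k = l then 1 else 0| ≤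
      1 / (2 * (p + 1)) := by
    refine eventually_all.2 fun k => eventually_all.2 fun l => ?_
    filter_upwards [(hx.tendsto_scov k l).eventually (Metric.closedBall_mem_nhds _ hp)] with n hn
    rwa [← Real.dist_eq]
  filter_upwards [this] with n hn
  refine half_sum_sq_le_c2 ?_ hn
  rw [div_mul_eq_mul_div, div_le_div_iff₀ (by positivity) (by norm_num)]
  linarith

theorem CenteredMomentsConverge.eventually_posDef (hx : CenteredMomentsConverge γ κ x) :
    ∀ᶠ n in atTop, (scov (firstPoints x n)).PosDef := by
  filter_upwards [hx.eventually_half_le] with n hn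
  refine Matrix.PosDef.of_dotProduct_mulVec_pos ?_ fun v hv => ?_
  · ext k l
    simp only [scov, Matrix.conjTranspose_apply, Matrix.of_apply, star_trivial]
    congr 1; ext y; ring
  · have h1 : 0 < ∑ k, v k ^ 2 := by
      obtain ⟨k, hk⟩ := Function.ne_iff.1 hv
      exact Finset.sum_pos' (fun _ _ => sq_nonneg _) ⟨k, Finset.mem_univ k, by
        have : v k ≠ 0 := hk
        positivity⟩
    have h2 := hn v
    rw [c2_eq_sum_scov] at h2
    have e : star v ⬝ᵥ (scov (firstPoints x n) *ᵥ v) =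
        ∑ k, ∑ l, v k * v l * scov (firstPoints x n) k l := by
      simp only [dotProduct, Matrix.mulVec, star_trivial, Finset.mul_sum]
      exact Finset.sum_congr rfl fun k _ => Finset.sum_congr rfl fun l _ => by ring
    rw [e]
    linarith

theorem CenteredMomentsConverge.tendsto_index (hx : CenteredMomentsConverge γ κ x) (α : ℝ)
    {L : Filter ℕ} (hL : L ≤ atTop) {W : ℕ → Matrix (Fin p) (Fin p) ℝ}
    {U : Matrix (Fin p) (Fin p) ℝ} (hU : U * Uᵀ = 1) (hW : Tendsto W L (𝓝 U)) :
    Tendsto (fun n => index α (firstPoints x n) (W n)) L (𝓝 (popIndex α γ κ U)) := by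
  have hr : ∀ k, Tendsto (fun n => W n k) L (𝓝 (U k)) := fun k => tendsto_pi_nhds.1 hW k
  have hd : ∀ k, U k ⬝ᵥ U k = 1 := fun k => by
    rw [← row_sq_sum hU k]
    exact Finset.sum_congr rfl fun j _ => (sq _).symm
  unfold index popIndex
  refine Tendsto.add (Tendsto.const_mul _ (tendsto_finsetSum _ fun k _ => ?_))
    (Tendsto.const_mul _ (tendsto_finsetSum _ fun k _ => ?_))
  · have := (hx.three hL (hr k) (hr k) (hr k)).pow 2
    convert this using 4
    ring
  · have := ((hx.four hL (hr k) (hr k) (hr k) (hr k)).sub_const 3).pow 2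
    convert this using 3
    rw [hd]
    have : ∀ j, κ j * (U k j * U k j * U k j * U k j) = κ j * U k j ^ 4 := fun j => by ring
    simp only [this]
    ring

/-- Solutions closest to the identity converge to the identity. -/
theorem CenteredMomentsConverge.tendsto_one (hx : CenteredMomentsConverge γ κ x) {α : ℝ}
    (h0 : 0 ≤ α) (h1 : α ≤ 1)
    (hc : ∀ k l, α * γ k ^ 2 + (1 - α) * κ k ^ 2 = 0 → α * γ l ^ 2 + (1 - α) * κ l ^ 2 = 0 → k = l)
    {W : ℕ → Matrix (Fin p) (Fin p) ℝ} (hW : ∀ᶠ n in atTop, IsOpt α (firstPoints x n) (W n) ∧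
      ∀ V, IsOpt α (firstPoints x n) V → distOne (W n) ≤ distOne V) :
    Tendsto W atTop (𝓝 1) := by
  have hbox : IsCompact (Set.pi Set.univ fun _ : Fin p => Set.pi Set.univ fun _ : Fin p =>
      Set.Icc (-2 : ℝ) 2) :=
    isCompact_univ_pi fun _ => isCompact_univ_pi fun _ => isCompact_Icc
  have hmem : ∀ᶠ n in atTop, W n ∈ (Set.pi Set.univ fun _ : Fin p => Set.pi Set.univ
      fun _ : Fin p => Set.Icc (-2 : ℝ) 2) := by
    filter_upwards [hW, hx.eventually_half_le] with n hn hn2 k _ l _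
    have h2 := hn2 (W n k)
    rw [c2_of_standardized _ hn.1.1, if_pos rfl] at h2
    -- A row with sample variance one has squared norm at most `2`, so its entries lie in `[-2, 2]`.
    have h3 := Finset.single_le_sum (f := fun l => W n k l ^ 2) (fun _ _ => sq_nonneg _)
      (Finset.mem_univ l)
    exact abs_le.1 (abs_le_of_sq_le_sq (by linarith) (by norm_num))
  -- Along every ultrafilter the bounded sequence has some limit `U`; it remains to show `U = 1`.
  rw [tendsto_iff_ultrafilter]
  intro L hL
  obtain ⟨U', -, hU⟩ := hbox.ultrafilter_le_nhds (L.map W)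
    (le_principal_iff.2 (hL hmem))
  set U : Matrix (Fin p) (Fin p) ℝ := Matrix.of U' with hUdef
  have hWU : Tendsto W L (𝓝 U) := hU
  have hr : ∀ k, Tendsto (fun n => W n k) L (𝓝 (U k)) := fun k => tendsto_pi_nhds.1 hWU k
  have hUU : U * Uᵀ = 1 := by
    ext k l
    have h2 := hx.two hL (hr k) (hr l)
    have h3 : Tendsto (fun n => c2 (firstPoints x n) (W n k) (W n l)) L
        (𝓝 ((1 : Matrix (Fin p) (Fin p) ℝ) k l)) := by
      refine tendsto_const_nhds.congr' ?_
      filter_upwards [hL hW] with n hn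
      rw [c2_of_standardized _ hn.1.1, Matrix.one_apply]
    exact tendsto_nhds_unique h2 h3
  have hUU' : Uᵀ * U = 1 := mul_eq_one_comm.1 hUU
  have hUt : Uᵀ * Uᵀᵀ = 1 := by rwa [Matrix.transpose_transpose]
  have hQW : Tendsto (fun n => Uᵀ * W n) L (𝓝 1) := by
    rw [← hUU']
    exact ((continuous_const (y := Uᵀ)).matrix_mul continuous_id).tendsto U |>.comp hWU
  -- The rotation `Uᵀ * W n` is a competitor that tends to the identity, so optimality of `W n`
  -- passes to the limit as this inequality.
  have hpop : popIndex α γ κ 1 ≤ popIndex α γ κ U := by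
    refine le_of_tendsto_of_tendsto (hx.tendsto_index α hL (by simp) hQW)
      (hx.tendsto_index α hL hUU hWU) ?_
    filter_upwards [hL hW] with n hn
    exact hn.1.2 _ (mem_orthogonalGroup_of hUt)
  have hperm := sq_eq_zero_or_one_of_popIndex_le h0 h1 hc hUU hpop
  -- Now `Uᵀ` is a signed permutation, so `Uᵀ * W n` is optimal too, and the closest choice cannot
  -- be farther from the identity than it. In the limit this gives `distOne U ≤ 0`.
  have hdist : ∀ᶠ n in (L : Filter ℕ), distOne (W n) ≤ distOne (Uᵀ * W n) := by
    filter_upwards [hL hW] with n hn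
    refine hn.2 _ ⟨standardized_mul (mem_orthogonalGroup_of hUt) hn.1.1, fun O hO => ?_⟩
    rw [index_signedPermutation_mul α _ hUt (fun k j => hperm j k), ← mul_assoc]
    exact hn.1.2 _ (mul_mem hO (mem_orthogonalGroup_of hUt))
  have hd1 : distOne U ≤ distOne (1 : Matrix (Fin p) (Fin p) ℝ) :=
    le_of_tendsto_of_tendsto ((continuous_distOne.tendsto U).comp hWU)
      ((continuous_distOne.tendsto 1).comp hQW) hdist
  have hU1 : U = 1 := by
    have h2 : distOne (1 : Matrix (Fin p) (Fin p) ℝ) = 0 := by simp [distOne]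
    have h3 : distOne U = 0 := le_antisymm (hd1.trans h2.le)
      (Finset.sum_nonneg fun _ _ => Finset.sum_nonneg fun _ _ => sq_nonneg _)
    ext k l
    rw [distOne, Finset.sum_eq_zero_iff_of_nonneg
      fun _ _ => Finset.sum_nonneg fun _ _ => sq_nonneg _] at h3
    have h4 := h3 k (Finset.mem_univ k)
    rw [Finset.sum_eq_zero_iff_of_nonneg fun _ _ => sq_nonneg _] at h4
    exact sub_eq_zero.1 (pow_eq_zero_iff two_ne_zero |>.1 (h4 l (Finset.mem_univ l)))
  rwa [hU1] at hWU

end Consistency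

/-! ### First-order conditions -/

section FirstOrder

variable {p n : ℕ}

/-- Rotation by the angle `θ` in the plane of the coordinates `k`, `l`. -/
def planeRotation (k l : Fin p) (θ : ℝ) : Matrix (Fin p) (Fin p) ℝ :=
  Matrix.of fun m => if m = k then Real.cos θ • Pi.single k 1 + Real.sin θ • Pi.single l 1
    else if m = l then Real.cos θ • Pi.single l 1 + Real.sin θ • -Pi.single k 1
    else Pi.single m 1

/-- Velocity at angle zero of the rows of a rotated matrix. -/
def planeVelocity (k l : Fin p) (W : Matrix (Fin p) (Fin p) ℝ) (m : Fin p) : Fin p → ℝ :=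
  if m = k then W l else if m = l then -W k else 0

theorem planeRotation_mul (k l : Fin p) (θ : ℝ) (W : Matrix (Fin p) (Fin p) ℝ) (m : Fin p) :
    (planeRotation k l θ * W) m = if m = k then Real.cos θ • W k + Real.sin θ • W l
      else if m = l then Real.cos θ • W l + Real.sin θ • -W k else W m := by
  ext j
  rw [Matrix.mul_apply]
  by_cases h1 : m = k
  · simp [planeRotation, h1, add_mul, Finset.sum_add_distrib, Pi.single_apply]
  · by_cases h2 : m = l
    · simp only [planeRotation, Matrix.of_apply, if_neg h1, if_pos h2, Pi.add_apply, Pi.smul_apply,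
        Pi.neg_apply, smul_eq_mul, add_mul, Finset.sum_add_distrib, Pi.single_apply]
      simp
    · simp [planeRotation, h1, h2, Pi.single_apply]

theorem planeRotation_mem {k l : Fin p} (hkl : k ≠ l) (θ : ℝ) :
    planeRotation k l θ ∈ Matrix.orthogonalGroup (Fin p) ℝ := by
  have hcs := Real.sin_sq_add_cos_sq θ
  refine mem_orthogonalGroup_of ?_
  ext m j
  rw [planeRotation_mul, Matrix.one_apply]
  have hlk := hkl.symm
  by_cases h1 : m = k
  · subst h1
    by_cases h2 : j = m
    · subst h2
      simp [planeRotation, hkl, hlk]; linarith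
    · by_cases h3 : j = l
      · subst h3
        simp [planeRotation, hkl, hlk]; ring
      · simp [planeRotation, h2, h3, Ne.symm h2, Ne.symm h3]
  · by_cases h2 : m = l
    · subst h2
      by_cases h3 : j = k
      · subst h3
        simp [planeRotation, hkl, hlk]; ring
      · by_cases h4 : j = m
        · subst h4
          simp [planeRotation, hkl, hlk]; linarith
        · simp [planeRotation, hlk, h3, h4, Ne.symm h4, Ne.symm h3]
    · by_cases h3 : j = k
      · subst h3
        simp [planeRotation, h1, h2]
      · by_cases h4 : j = l
        · subst h4
          simp [planeRotation, h1, h2, h3]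
        · simp [planeRotation, h1, h2, h3, h4, Pi.single_apply]

theorem hasDerivAt_planeRotation_dot (k l : Fin p) (W : Matrix (Fin p) (Fin p) ℝ) (m : Fin p)
    (y : Fin p → ℝ) :
    HasDerivAt (fun θ => (planeRotation k l θ * W) m ⬝ᵥ y) (planeVelocity k l W m ⬝ᵥ y) 0 := by
  have h : ∀ a b : Fin p → ℝ,
      HasDerivAt (fun θ => (Real.cos θ • a + Real.sin θ • b) ⬝ᵥ y) (b ⬝ᵥ y) 0 := by
    intro a b
    simp only [add_dotProduct, smul_dotProduct, smul_eq_mul]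
    have := ((Real.hasDerivAt_cos 0).mul_const (a ⬝ᵥ y)).add
      ((Real.hasDerivAt_sin 0).mul_const (b ⬝ᵥ y))
    exact this.congr_deriv (by simp)
  simp only [planeRotation_mul, planeVelocity]
  split_ifs
  · exact h _ _
  · exact h _ _
  · simpa using hasDerivAt_const (0 : ℝ) (W m ⬝ᵥ y)

variable (x : Fin n → Fin p → ℝ)

theorem hasDerivAt_c3 {r : ℝ → Fin p → ℝ} {t : Fin p → ℝ}
    (h : ∀ y, HasDerivAt (fun θ => r θ ⬝ᵥ y) (t ⬝ᵥ y) 0) :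
    HasDerivAt (fun θ => c3 x (r θ) (r θ) (r θ)) (3 * c3 x (r 0) (r 0) t) 0 := by
  have := (HasDerivAt.fun_sum (u := Finset.univ) fun i _ =>
    ((h (x i - xbar x)).fun_pow 3)).const_mul (n : ℝ)⁻¹
  have e : (fun θ => c3 x (r θ) (r θ) (r θ)) =
      fun θ => (n : ℝ)⁻¹ * ∑ i, (r θ ⬝ᵥ (x i - xbar x)) ^ 3 := by
    ext θ
    simp only [c3, emean]
    congr 2; ext i; ring
  rw [e]
  refine this.congr_deriv ?_
  simp only [c3, emean, Finset.mul_sum]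
  refine Finset.sum_congr rfl fun i _ => ?_
  push_cast; ring

theorem hasDerivAt_c4 {r : ℝ → Fin p → ℝ} {t : Fin p → ℝ}
    (h : ∀ y, HasDerivAt (fun θ => r θ ⬝ᵥ y) (t ⬝ᵥ y) 0) :
    HasDerivAt (fun θ => c4 x (r θ) (r θ) (r θ) (r θ)) (4 * c4 x (r 0) (r 0) (r 0) t) 0 := by
  have := (HasDerivAt.fun_sum (u := Finset.univ) fun i _ =>
    ((h (x i - xbar x)).fun_pow 4)).const_mul (n : ℝ)⁻¹
  have e : (fun θ => c4 x (r θ) (r θ) (r θ) (r θ)) =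
      fun θ => (n : ℝ)⁻¹ * ∑ i, (r θ ⬝ᵥ (x i - xbar x)) ^ 4 := by
    ext θ
    simp only [c4, emean]
    congr 2; ext i; ring
  rw [e]
  refine this.congr_deriv ?_
  simp only [c4, emean, Finset.mul_sum]
  refine Finset.sum_congr rfl fun i _ => ?_
  push_cast; ring

variable {x}

/-- The index along the plane rotations has a maximum at angle zero, so its derivative vanishes
there. Only rows `k` and `l` move, with velocities `W l` and `-W k`; the factors `3` and `4` come
from the degrees of the moments. -/
theorem IsOpt.first_order {α : ℝ} {W : Matrix (Fin p) (Fin p) ℝ} (h : IsOpt α x W) {k l : Fin p}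
    (hkl : k ≠ l) :
    3 * α * (c3 x (W k) (W k) (W k) * c3 x (W k) (W k) (W l)) +
        4 * (1 - α) * ((c4 x (W k) (W k) (W k) (W k) - 3) * c4 x (W k) (W k) (W k) (W l)) =
      3 * α * (c3 x (W l) (W l) (W l) * c3 x (W l) (W l) (W k)) +
        4 * (1 - α) * ((c4 x (W l) (W l) (W l) (W l) - 3) * c4 x (W l) (W l) (W l) (W k)) := by
  have hr0 : ∀ m, (planeRotation k l 0 * W) m = W m := fun m => by
    rw [planeRotation_mul]
    split_ifs with h1 h2
    · simp [h1]
    · simp [h2]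
    · rfl
  have hd3 : ∀ m, _ := fun m => (hasDerivAt_c3 x (hasDerivAt_planeRotation_dot k l W m)).fun_pow 2
  have hd4 : ∀ m, _ := fun m =>
    ((hasDerivAt_c4 x (hasDerivAt_planeRotation_dot k l W m)).sub_const 3).fun_pow 2
  have hd := ((HasDerivAt.fun_sum (u := Finset.univ) fun m _ => hd3 m).const_mul α).add
    ((HasDerivAt.fun_sum (u := Finset.univ) fun m _ => hd4 m).const_mul (1 - α))
  have hmax : IsLocalMax (fun θ => index α x (planeRotation k l θ * W)) 0 := by
    refine Eventually.of_forall fun θ => ?_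
    have e : planeRotation k l 0 * W = W := funext hr0
    simp only [e]
    exact h.2 _ (planeRotation_mem hkl θ)
  have h0 := hmax.hasDerivAt_eq_zero hd
  simp only [hr0] at h0
  have hv : ∀ m, m ≠ k ∧ m ≠ l → planeVelocity k l W m = 0 := fun m hm => by
    rw [planeVelocity, if_neg hm.1, if_neg hm.2]
  have hvk : planeVelocity k l W k = W l := if_pos rfl
  have hvl : planeVelocity k l W l = -W k := by rw [planeVelocity, if_neg hkl.symm, if_pos rfl]
  have z3 : ∀ u v : Fin p → ℝ, c3 x u v 0 = 0 := fun u v => by simp [c3, emean]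
  have z4 : ∀ u v w : Fin p → ℝ, c4 x u v w 0 = 0 := fun u v w => by simp [c4, emean]
  have n3 : ∀ u v w : Fin p → ℝ, c3 x u v (-w) = -c3 x u v w := fun u v w => by
    simp only [c3, emean, neg_dotProduct, mul_neg, Finset.sum_neg_distrib]
  have n4 : ∀ u v w t : Fin p → ℝ, c4 x u v w (-t) = -c4 x u v w t := fun u v w t => by
    simp only [c4, emean, neg_dotProduct, mul_neg, Finset.sum_neg_distrib]
  rw [Finset.sum_eq_add k l hkl (fun m _ hm => by rw [hv m hm, z3]; ring) (by simp) (by simp),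
    Finset.sum_eq_add k l hkl (fun m _ hm => by rw [hv m hm, z4]; ring) (by simp) (by simp),
    hvk, hvl, n3, n4] at h0
  push_cast at h0
  linear_combination h0 / 2

end FirstOrder

/-! ### Linearization -/

section Linearize

variable {p n : ℕ} (x : Fin n → Fin p → ℝ)

theorem dotProduct_eq_sum_single (w y : Fin p → ℝ) :
    w ⬝ᵥ y = ∑ j, w j * ((Pi.single j 1 : Fin p → ℝ) ⬝ᵥ y) := by
  simp only [single_dotProduct, one_mul]
  rfl

theorem c2_eq_sum (u w : Fin p → ℝ) :
    c2 x u w = ∑ j, w j * c2 x u (Pi.single j 1) := by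
  simp only [c2, ← emean_const_mul, ← emean_sum]
  congr 1; ext y
  rw [dotProduct_eq_sum_single w, Finset.mul_sum]
  exact Finset.sum_congr rfl fun j _ => by ring

theorem c3_eq_sum (u v w : Fin p → ℝ) :
    c3 x u v w = ∑ j, w j * c3 x u v (Pi.single j 1) := by
  simp only [c3, ← emean_const_mul, ← emean_sum]
  congr 1; ext y
  rw [dotProduct_eq_sum_single w, Finset.mul_sum]
  exact Finset.sum_congr rfl fun j _ => by ring

theorem c4_eq_sum (u v t w : Fin p → ℝ) :
    c4 x u v t w = ∑ j, w j * c4 x u v t (Pi.single j 1) := by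
  simp only [c4, ← emean_const_mul, ← emean_sum]
  congr 1; ext y
  rw [dotProduct_eq_sum_single w, Finset.mul_sum]
  exact Finset.sum_congr rfl fun j _ => by ring

/-- Telescoping: arguments are replaced one at a time, so every term is linear in one deviation
while its other arguments converge. The two analogues below have the same purpose. -/
theorem c2_sub (u v u₀ v₀ : Fin p → ℝ) :
    c2 x u v - c2 x u₀ v₀ = c2 x u (v - v₀) + c2 x v₀ (u - u₀) := by
  simp only [c2, ← emean_add, ← emean_sub, sub_dotProduct]
  congr 1; ext y; ring

theorem c3_sub (u v u₀ v₀ : Fin p → ℝ) :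
    c3 x u u v - c3 x u₀ u₀ v₀ =
      c3 x u u (v - v₀) + c3 x u v₀ (u - u₀) + c3 x u₀ v₀ (u - u₀) := by
  simp only [c3, ← emean_add, ← emean_sub, sub_dotProduct]
  congr 1; ext y; ring

theorem c4_sub (u v u₀ v₀ : Fin p → ℝ) :
    c4 x u u u v - c4 x u₀ u₀ u₀ v₀ = c4 x u u u (v - v₀) + c4 x u u v₀ (u - u₀) +
      c4 x u u₀ v₀ (u - u₀) + c4 x u₀ u₀ v₀ (u - u₀) := by
  simp only [c4, ← emean_add, ← emean_sub, sub_dotProduct]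
  congr 1; ext y; ring

theorem emean_sub_xbar (k : Fin p) : emean x (fun y => y k - xbar x k) = 0 := by
  simpa using emean_centered x (Pi.single k 1)

variable {x}

theorem sHat_eq (hn : n ≠ 0) (k l : Fin p) :
    sHat x k l = c2 x (Pi.single k 1) (Pi.single l 1) + xbar x k * xbar x l := by
  have e : sHat x k l = emean x fun y => (y k - xbar x k) * (y l - xbar x l) +
      xbar x l * (y k - xbar x k) + xbar x k * (y l - xbar x l) + xbar x k * xbar x l := by
    simp only [sHat, emean]; congr 2; ext i; ring
  rw [e]
  simp only [emean_add, emean_const_mul, emean_sub_xbar, emean_const x hn, c2,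
    single_dotProduct, one_mul, Pi.sub_apply, mul_zero, add_zero]

/-- The correction is grouped as sample means times factors that tend to zero for standardized data
when `k ≠ l`. Subtracting `1` from the square makes the first factor small; in `qHat_eq` subtracting
`γ k` from the cube plays that role. -/
theorem rHat_eq (hn : n ≠ 0) (k l : Fin p) :
    rHat x k l = c3 x (Pi.single k 1) (Pi.single k 1) (Pi.single l 1) +
      (xbar x l * (c2 x (Pi.single k 1) (Pi.single k 1) - 1) +
        xbar x k * (2 * c2 x (Pi.single k 1) (Pi.single l 1)) +
        xbar x k * (xbar x k * xbar x l)) := by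
  have e : rHat x k l = emean x fun y =>
      (y k - xbar x k) * (y k - xbar x k) * (y l - xbar x l) +
      xbar x l * ((y k - xbar x k) * (y k - xbar x k)) +
      (2 * xbar x k) * ((y k - xbar x k) * (y l - xbar x l)) +
      (xbar x k ^ 2 - 1) * (y l - xbar x l) + (2 * xbar x k * xbar x l) * (y k - xbar x k) +
      (xbar x k ^ 2 - 1) * xbar x l := by
    simp only [rHat, emean]; congr 2; ext i; ring
  rw [e]
  simp only [emean_add, emean_const_mul, emean_sub_xbar, emean_const x hn, c2, c3,
    single_dotProduct, one_mul, Pi.sub_apply, mul_zero, add_zero]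
  ring

theorem qHat_eq (hn : n ≠ 0) (γ : Fin p → ℝ) (k l : Fin p) :
    qHat γ x k l = c4 x (Pi.single k 1) (Pi.single k 1) (Pi.single k 1) (Pi.single l 1) +
      (xbar x l * (c3 x (Pi.single k 1) (Pi.single k 1) (Pi.single k 1) - γ k) +
        xbar x k * (3 * c3 x (Pi.single k 1) (Pi.single k 1) (Pi.single l 1)) +
        xbar x k * (3 * xbar x l * c2 x (Pi.single k 1) (Pi.single k 1)) +
        xbar x k * (3 * xbar x k * c2 x (Pi.single k 1) (Pi.single l 1)) +
        xbar x k * (xbar x k ^ 2 * xbar x l)) := by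
  have e : qHat γ x k l = emean x fun y =>
      (y k - xbar x k) * (y k - xbar x k) * (y k - xbar x k) * (y l - xbar x l) +
      xbar x l * ((y k - xbar x k) * (y k - xbar x k) * (y k - xbar x k)) +
      (3 * xbar x k) * ((y k - xbar x k) * (y k - xbar x k) * (y l - xbar x l)) +
      (3 * xbar x k * xbar x l) * ((y k - xbar x k) * (y k - xbar x k)) +
      (3 * xbar x k ^ 2) * ((y k - xbar x k) * (y l - xbar x l)) +
      (xbar x k ^ 3 - γ k) * (y l - xbar x l) + (3 * xbar x k ^ 2 * xbar x l) * (y k - xbar x k) +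
      (xbar x k ^ 3 - γ k) * xbar x l := by
    simp only [qHat, emean]; congr 2; ext i; ring
  rw [e]
  simp only [emean_add, emean_const_mul, emean_sub_xbar, emean_const x hn, c2, c3, c4,
    single_dotProduct, one_mul, Pi.sub_apply, mul_zero, add_zero]
  ring

end Linearize

open Asymptotics

/-! ### Pathwise asymptotic expansions -/

section Expansion

variable {p : ℕ}

/-- Total size of the sampling errors that drive the expansions. -/
def noise {n : ℕ} (γ : Fin p → ℝ) (x : Fin n → Fin p → ℝ) : ℝ :=
  ∑ k, |xbar x k| + ∑ k, ∑ l, (|sHat x k l - if k = l then 1 else 0| +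
    -- Diagonal terms are left out because `r̂ₖₖ` and `q̂ₖₖ` are not centered: their means are `γₖ`
    -- and `βₖ`.
    if k = l then 0 else |rHat x k l| + |qHat γ x k l|)

theorem noise_inner_nonneg {n : ℕ} (γ : Fin p → ℝ) (x : Fin n → Fin p → ℝ) (k l : Fin p) :
    0 ≤ |sHat x k l - if k = l then 1 else 0| +
      if k = l then 0 else |rHat x k l| + |qHat γ x k l| := by
  split_ifs <;> positivity

theorem noise_nonneg {n : ℕ} (γ : Fin p → ℝ) (x : Fin n → Fin p → ℝ) : 0 ≤ noise γ x :=
  add_nonneg (Finset.sum_nonneg fun _ _ => abs_nonneg _)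
    (Finset.sum_nonneg fun k _ => Finset.sum_nonneg fun l _ => noise_inner_nonneg γ x k l)

theorem abs_xbar_le_noise {n : ℕ} (γ : Fin p → ℝ) (x : Fin n → Fin p → ℝ) (k : Fin p) :
    |xbar x k| ≤ noise γ x :=
  (Finset.single_le_sum (f := fun k => |xbar x k|) (fun _ _ => abs_nonneg _)
    (Finset.mem_univ k)).trans (le_add_of_nonneg_right
      (Finset.sum_nonneg fun k _ => Finset.sum_nonneg fun l _ => noise_inner_nonneg γ x k l))

theorem noise_inner_le_noise {n : ℕ} (γ : Fin p → ℝ) (x : Fin n → Fin p → ℝ) (k l : Fin p) :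
    (|sHat x k l - if k = l then 1 else 0| +
      if k = l then 0 else |rHat x k l| + |qHat γ x k l|) ≤ noise γ x :=
  ((Finset.single_le_sum (f := fun l => |sHat x k l - if k = l then 1 else 0| +
      if k = l then 0 else |rHat x k l| + |qHat γ x k l|)
    (fun l _ => noise_inner_nonneg γ x k l) (Finset.mem_univ l)).trans
    (Finset.single_le_sum (f := fun k => ∑ l, (|sHat x k l - if k = l then 1 else 0| +
      if k = l then 0 else |rHat x k l| + |qHat γ x k l|))
      (fun k _ => Finset.sum_nonneg fun l _ => noise_inner_nonneg γ x k l)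
      (Finset.mem_univ k))).trans
    (le_add_of_nonneg_left (Finset.sum_nonneg fun _ _ => abs_nonneg _))

theorem abs_sHat_le_noise {n : ℕ} (γ : Fin p → ℝ) (x : Fin n → Fin p → ℝ) (k l : Fin p) :
    |sHat x k l - if k = l then 1 else 0| ≤ noise γ x := by
  refine le_trans (le_add_of_nonneg_right ?_) (noise_inner_le_noise γ x k l)
  split_ifs <;> positivity

theorem abs_rHat_le_noise {n : ℕ} (γ : Fin p → ℝ) (x : Fin n → Fin p → ℝ) {k l : Fin p}
    (hkl : k ≠ l) : |rHat x k l| ≤ noise γ x := by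
  have := noise_inner_le_noise γ x k l
  rw [if_neg hkl, if_neg hkl] at this
  linarith [abs_nonneg (sHat x k l - 0), abs_nonneg (qHat γ x k l)]

theorem abs_qHat_le_noise {n : ℕ} (γ : Fin p → ℝ) (x : Fin n → Fin p → ℝ) {k l : Fin p}
    (hkl : k ≠ l) : |qHat γ x k l| ≤ noise γ x := by
  have := noise_inner_le_noise γ x k l
  rw [if_neg hkl, if_neg hkl] at this
  linarith [abs_nonneg (sHat x k l - 0), abs_nonneg (rHat x k l)]

theorem isBigO_of_abs_le {f g : ℕ → ℝ} (h : ∀ n, |f n| ≤ g n) : f =O[atTop] g :=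
  IsBigO.of_bound 1 (Eventually.of_forall fun n => by
    rw [one_mul, Real.norm_eq_abs, Real.norm_eq_abs]
    exact (h n).trans (le_abs_self _))

/-- Total entrywise deviation from the identity matrix. -/
def deviation (W : Matrix (Fin p) (Fin p) ℝ) : ℝ :=
  ∑ k, ∑ l, |W k l - (1 : Matrix (Fin p) (Fin p) ℝ) k l|

theorem abs_le_deviation (W : Matrix (Fin p) (Fin p) ℝ) (k l : Fin p) :
    |W k l - (1 : Matrix (Fin p) (Fin p) ℝ) k l| ≤ deviation W :=
  (Finset.single_le_sum (f := fun l => |W k l - (1 : Matrix (Fin p) (Fin p) ℝ) k l|)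
    (fun _ _ => abs_nonneg _) (Finset.mem_univ l)).trans
    (Finset.single_le_sum (f := fun k => ∑ l, |W k l - (1 : Matrix (Fin p) (Fin p) ℝ) k l|)
      (fun _ _ => Finset.sum_nonneg fun _ _ => abs_nonneg _) (Finset.mem_univ k))

theorem deviation_nonneg (W : Matrix (Fin p) (Fin p) ℝ) : 0 ≤ deviation W :=
  Finset.sum_nonneg fun _ _ => Finset.sum_nonneg fun _ _ => abs_nonneg _

/-- Replacing converging coefficients of a linear form by their limits costs `o(1)` times the size
of the argument. -/
theorem isLittleO_linear_form {T : ℕ → (Fin p → ℝ) → ℝ} {τ : Fin p → ℝ}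
    (hlin : ∀ n w, T n w = ∑ j, w j * T n (Pi.single j 1))
    (hT : ∀ j, Tendsto (fun n => T n (Pi.single j 1)) atTop (𝓝 (τ j)))
    {D : ℕ → Fin p → ℝ} {g : ℕ → ℝ} (hD : ∀ j, (fun n => D n j) =O[atTop] g) :
    (fun n => T n (D n) - ∑ j, D n j * τ j) =o[atTop] g := by
  have e : (fun n => T n (D n) - ∑ j, D n j * τ j) =
      fun n => ∑ j, D n j * (T n (Pi.single j 1) - τ j) := by
    ext n
    rw [hlin n (D n), ← Finset.sum_sub_distrib]
    exact Finset.sum_congr rfl fun j _ => by ring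
  rw [e]
  refine IsLittleO.fun_sum fun j _ => ?_
  have h1 : (fun n => T n (Pi.single j 1) - τ j) =o[atTop] fun _ => (1 : ℝ) := by
    rw [isLittleO_one_iff]
    simpa using (hT j).sub_const (τ j)
  simpa using (hD j).mul_isLittleO h1

variable {γ κ : Fin p → ℝ} {x : ℕ → Fin p → ℝ}

section SampleRemainders

variable (hx : CenteredMomentsConverge γ κ x)

theorem xbar_mul_isLittleO {h : ℕ → ℝ} (k : Fin p) (hh : Tendsto h atTop (𝓝 0)) :
    (fun n => xbar (firstPoints x n) k * h n) =o[atTop] fun n => noise γ (firstPoints x n) := by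
  have h1 := (isLittleO_one_iff ℝ).2 hh
  have h2 := isBigO_of_abs_le fun n => abs_xbar_le_noise γ (firstPoints x n) k
  simpa using h2.mul_isLittleO h1

include hx

theorem tendsto_c2_single (k l : Fin p) :
    Tendsto (fun n => c2 (firstPoints x n) (Pi.single k 1) (Pi.single l 1)) atTop
      (𝓝 (if k = l then 1 else 0)) := by
  simpa only [scov_apply] using hx.tendsto_scov k l

theorem tendsto_c3_single (k l : Fin p) :
    Tendsto (fun n => c3 (firstPoints x n) (Pi.single k 1) (Pi.single k 1) (Pi.single l 1)) atTop
      (𝓝 (if k = l then γ k else 0)) := by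
  have := hx.three le_rfl (tendsto_const_nhds (x := (Pi.single k 1 : Fin p → ℝ)))
    (tendsto_const_nhds (x := (Pi.single k 1 : Fin p → ℝ)))
    (tendsto_const_nhds (x := (Pi.single l 1 : Fin p → ℝ)))
  by_cases hkl : k = l
  · subst hkl
    simpa [Pi.single_apply] using this
  · simpa [Pi.single_apply, hkl, Ne.symm hkl] using this

theorem c2_sub_sHat_isLittleO (k l : Fin p) :
    (fun n => c2 (firstPoints x n) (Pi.single k 1) (Pi.single l 1) -
      sHat (firstPoints x n) k l) =o[atTop] fun n => noise γ (firstPoints x n) := by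
  have := (xbar_mul_isLittleO (γ := γ) (x := x) k (hx.xbar l)).neg_left
  refine this.congr' ?_ EventuallyEq.rfl
  filter_upwards [eventually_ne_atTop 0] with n hn
  rw [sHat_eq hn]; ring

theorem c3_sub_rHat_isLittleO {k l : Fin p} (hkl : k ≠ l) :
    (fun n => c3 (firstPoints x n) (Pi.single k 1) (Pi.single k 1) (Pi.single l 1) -
      rHat (firstPoints x n) k l) =o[atTop] fun n => noise γ (firstPoints x n) := by
  have h1 := tendsto_c2_single hx k k
  have h2 := tendsto_c2_single hx k l
  rw [if_pos rfl] at h1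
  rw [if_neg hkl] at h2
  have := (((xbar_mul_isLittleO (γ := γ) (x := x) l (by simpa using h1.sub_const 1)).add
    (xbar_mul_isLittleO (γ := γ) (x := x) k (by simpa using h2.const_mul 2))).add
    (xbar_mul_isLittleO (γ := γ) (x := x) k (by simpa using (hx.xbar k).mul (hx.xbar l)))).neg_left
  refine this.congr' ?_ EventuallyEq.rfl
  filter_upwards [eventually_ne_atTop 0] with n hn
  rw [rHat_eq hn]; ring

theorem c4_sub_qHat_isLittleO {k l : Fin p} (hkl : k ≠ l) :
    (fun n => c4 (firstPoints x n) (Pi.single k 1) (Pi.single k 1) (Pi.single k 1)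
      (Pi.single l 1) - qHat γ (firstPoints x n) k l) =o[atTop]
        fun n => noise γ (firstPoints x n) := by
  have h1 := tendsto_c2_single hx k k
  have h2 := tendsto_c2_single hx k l
  have h3 := tendsto_c3_single hx k k
  have h4 := tendsto_c3_single hx k l
  rw [if_pos rfl] at h1 h3
  rw [if_neg hkl] at h2 h4
  have hk := hx.xbar k
  have hl := hx.xbar l
  have := (((((xbar_mul_isLittleO (γ := γ) (x := x) l (by simpa using h3.sub_const (γ k))).add
    (xbar_mul_isLittleO (γ := γ) (x := x) k (by simpa using h4.const_mul 3))).add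
    (xbar_mul_isLittleO (γ := γ) (x := x) k (by simpa using (hl.const_mul 3).mul h1))).add
    (xbar_mul_isLittleO (γ := γ) (x := x) k (by simpa using (hk.const_mul 3).mul h2))).add
    (xbar_mul_isLittleO (γ := γ) (x := x) k (by simpa using (hk.pow 2).mul hl))).neg_left
  refine this.congr' ?_ EventuallyEq.rfl
  filter_upwards [eventually_ne_atTop 0] with n hn
  rw [qHat_eq hn]; ring

end SampleRemainders

/-- The matrices `W n` approach the identity and standardize the first `n` points. -/
structure Standardizes (γ κ : Fin p → ℝ) (x : ℕ → Fin p → ℝ)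
    (W : ℕ → Matrix (Fin p) (Fin p) ℝ) : Prop where
  moments : CenteredMomentsConverge γ κ x
  lim : Tendsto W atTop (𝓝 1)
  std : ∀ᶠ n in atTop, W n * scov (firstPoints x n) * (W n)ᵀ = 1

variable {W : ℕ → Matrix (Fin p) (Fin p) ℝ}

/-- Deviation from the identity plus sampling noise. -/
def gauge (γ : Fin p → ℝ) (x : ℕ → Fin p → ℝ) (W : ℕ → Matrix (Fin p) (Fin p) ℝ) (n : ℕ) : ℝ :=
  deviation (W n) + noise γ (firstPoints x n)

theorem noise_isBigO_gauge :
    (fun n => noise γ (firstPoints x n)) =O[atTop] gauge γ x W :=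
  isBigO_of_abs_le fun n => by
    rw [abs_of_nonneg (noise_nonneg _ _)]
    exact le_add_of_nonneg_left (deviation_nonneg _)

theorem entry_isBigO_gauge (k l : Fin p) :
    (fun n => W n k l - (1 : Matrix (Fin p) (Fin p) ℝ) k l) =O[atTop] gauge γ x W :=
  isBigO_of_abs_le fun n =>
    (abs_le_deviation (W n) k l).trans (le_add_of_nonneg_right (noise_nonneg _ _))

theorem offDiag_isBigO_gauge {k l : Fin p} (hkl : k ≠ l) :
    (fun n => W n k l) =O[atTop] gauge γ x W := by
  simpa [Matrix.one_apply_ne hkl] using entry_isBigO_gauge (γ := γ) (x := x) (W := W) k l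

theorem row_sub_isBigO_gauge (k j : Fin p) :
    (fun n => (W n k - Pi.single k 1 : Fin p → ℝ) j) =O[atTop] gauge γ x W := by
  simpa [← one_row] using entry_isBigO_gauge (γ := γ) (x := x) (W := W) k j

namespace Standardizes

variable (h : Standardizes γ κ x W)
include h

theorem row (k : Fin p) : Tendsto (fun n => W n k) atTop (𝓝 (Pi.single k 1)) := by
  rw [← one_row]
  exact tendsto_pi_nhds.1 h.lim k

/-- In the telescoped difference the limiting form is the inner product, so perturbing row `l` picks
out entry `(l, k)` and perturbing row `k` picks out entry `(k, l)`. -/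
theorem c2_expansion (k l : Fin p) :
    (fun n => c2 (firstPoints x n) (W n k) (W n l) -
      (sHat (firstPoints x n) k l + (W n l k - (1 : Matrix (Fin p) (Fin p) ℝ) l k) +
        (W n k l - (1 : Matrix (Fin p) (Fin p) ℝ) k l))) =o[atTop] gauge γ x W := by
  have h1 := isLittleO_linear_form (T := fun n w => c2 (firstPoints x n) (W n k) w)
    (fun n w => c2_eq_sum _ _ w)
    (fun j => h.moments.two le_rfl (h.row k) (tendsto_const_nhds (x := Pi.single j 1)))
    (row_sub_isBigO_gauge (γ := γ) (x := x) (W := W) l)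
  have h2 := isLittleO_linear_form (T := fun n w => c2 (firstPoints x n) (Pi.single l 1) w)
    (fun n w => c2_eq_sum _ _ w)
    (fun j => h.moments.two le_rfl (tendsto_const_nhds (x := Pi.single l 1))
      (tendsto_const_nhds (x := Pi.single j 1)))
    (row_sub_isBigO_gauge (γ := γ) (x := x) (W := W) k)
  have h3 := (c2_sub_sHat_isLittleO h.moments k l).trans_isBigO
    (noise_isBigO_gauge (γ := γ) (x := x) (W := W))
  refine ((h1.add h2).add h3).congr_left fun n => ?_
  have e := c2_sub (firstPoints x n) (W n k) (W n l) (Pi.single k 1) (Pi.single l 1)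
  simp only [single_dotProduct, Pi.single_apply, mul_ite, mul_one, mul_zero,
    Finset.sum_ite_eq, Finset.mem_univ, if_true, Pi.sub_apply,
    Matrix.one_apply]
  simp only [eq_comm (a := l) (b := k)]
  linear_combination -e

/-- Only the perturbation of row `l` survives, through `E zₖ³ = γₖ`. Perturbing row `k` meets `E zₖ
zₗ zⱼ`, which is zero for every `j` since `k ≠ l`. -/
theorem c3_expansion {k l : Fin p} (hkl : k ≠ l) :
    (fun n => c3 (firstPoints x n) (W n k) (W n k) (W n l) -
      (rHat (firstPoints x n) k l + γ k * W n l k)) =o[atTop] gauge γ x W := by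
  have ek := tendsto_const_nhds (f := (atTop : Filter ℕ)) (x := (Pi.single k 1 : Fin p → ℝ))
  have el := tendsto_const_nhds (f := (atTop : Filter ℕ)) (x := (Pi.single l 1 : Fin p → ℝ))
  have ej := fun j => tendsto_const_nhds (f := (atTop : Filter ℕ))
    (x := (Pi.single j 1 : Fin p → ℝ))
  have h1 := isLittleO_linear_form (T := fun n w => c3 (firstPoints x n) (W n k) (W n k) w)
    (fun n w => c3_eq_sum _ _ _ w)
    (fun j => h.moments.three le_rfl (h.row k) (h.row k) (ej j))
    (row_sub_isBigO_gauge (γ := γ) (x := x) (W := W) l)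
  have h2 := isLittleO_linear_form (T := fun n w => c3 (firstPoints x n) (W n k) (Pi.single l 1) w)
    (fun n w => c3_eq_sum _ _ _ w)
    (fun j => h.moments.three le_rfl (h.row k) el (ej j))
    (row_sub_isBigO_gauge (γ := γ) (x := x) (W := W) k)
  have h3 := isLittleO_linear_form
    (T := fun n w => c3 (firstPoints x n) (Pi.single k 1) (Pi.single l 1) w)
    (fun n w => c3_eq_sum _ _ _ w)
    (fun j => h.moments.three le_rfl ek el (ej j))
    (row_sub_isBigO_gauge (γ := γ) (x := x) (W := W) k)
  have h4 := (c3_sub_rHat_isLittleO h.moments hkl).trans_isBigO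
    (noise_isBigO_gauge (γ := γ) (x := x) (W := W))
  refine (((h1.add h2).add h3).add h4).congr_left fun n => ?_
  have e := c3_sub (firstPoints x n) (W n k) (W n l) (Pi.single k 1) (Pi.single l 1)
  have s1 : ∑ j, (W n l - Pi.single l 1 : Fin p → ℝ) j * ∑ i, γ i *
      ((Pi.single k 1 : Fin p → ℝ) i * (Pi.single k 1 : Fin p → ℝ) i *
        (Pi.single j 1 : Fin p → ℝ) i) = γ k * W n l k := by
    simp [Pi.single_apply, hkl, mul_comm]
  have s2 : ∀ j, ∑ i, γ i * ((Pi.single k 1 : Fin p → ℝ) i * (Pi.single l 1 : Fin p → ℝ) i *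
      (Pi.single j 1 : Fin p → ℝ) i) = 0 := fun j => by
    simp only [Pi.single_apply, mul_ite, mul_one, mul_zero, Finset.sum_ite_eq',
      Finset.mem_univ, if_true]
    split_ifs <;> simp_all
  simp only [s1, s2, mul_zero, Finset.sum_const_zero]
  linear_combination -e

/-- Perturbing row `l` contributes `E zₖ⁴ = κₖ + 3` times entry `(l, k)`. Each of the three
occurrences of row `k` contributes `E zₖ² zₗ² = 1` times entry `(k, l)`. -/
theorem c4_expansion {k l : Fin p} (hkl : k ≠ l) :
    (fun n => c4 (firstPoints x n) (W n k) (W n k) (W n k) (W n l) -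
      (qHat γ (firstPoints x n) k l + (κ k + 3) * W n l k + 3 * W n k l)) =o[atTop]
        gauge γ x W := by
  have ek := tendsto_const_nhds (f := (atTop : Filter ℕ)) (x := (Pi.single k 1 : Fin p → ℝ))
  have el := tendsto_const_nhds (f := (atTop : Filter ℕ)) (x := (Pi.single l 1 : Fin p → ℝ))
  have ej := fun j => tendsto_const_nhds (f := (atTop : Filter ℕ))
    (x := (Pi.single j 1 : Fin p → ℝ))
  have h1 := isLittleO_linear_form
    (T := fun n w => c4 (firstPoints x n) (W n k) (W n k) (W n k) w)
    (fun n w => c4_eq_sum _ _ _ _ w)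
    (fun j => h.moments.four le_rfl (h.row k) (h.row k) (h.row k) (ej j))
    (row_sub_isBigO_gauge (γ := γ) (x := x) (W := W) l)
  have h2 := isLittleO_linear_form
    (T := fun n w => c4 (firstPoints x n) (W n k) (W n k) (Pi.single l 1) w)
    (fun n w => c4_eq_sum _ _ _ _ w)
    (fun j => h.moments.four le_rfl (h.row k) (h.row k) el (ej j))
    (row_sub_isBigO_gauge (γ := γ) (x := x) (W := W) k)
  have h3 := isLittleO_linear_form
    (T := fun n w => c4 (firstPoints x n) (W n k) (Pi.single k 1) (Pi.single l 1) w)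
    (fun n w => c4_eq_sum _ _ _ _ w)
    (fun j => h.moments.four le_rfl (h.row k) ek el (ej j))
    (row_sub_isBigO_gauge (γ := γ) (x := x) (W := W) k)
  have h4 := isLittleO_linear_form
    (T := fun n w => c4 (firstPoints x n) (Pi.single k 1) (Pi.single k 1) (Pi.single l 1) w)
    (fun n w => c4_eq_sum _ _ _ _ w)
    (fun j => h.moments.four le_rfl ek ek el (ej j))
    (row_sub_isBigO_gauge (γ := γ) (x := x) (W := W) k)
  have h5 := (c4_sub_qHat_isLittleO h.moments hkl).trans_isBigO
    (noise_isBigO_gauge (γ := γ) (x := x) (W := W))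
  refine ((((h1.add h2).add h3).add h4).add h5).congr_left fun n => ?_
  have e := c4_sub (firstPoints x n) (W n k) (W n l) (Pi.single k 1) (Pi.single l 1)
  have hlk := hkl.symm
  simp [Pi.single_apply, hkl, hlk, mul_add, Finset.sum_add_distrib]
  linear_combination -e

end Standardizes

end Expansion

/-! ### Solving the linearized equations -/

section Expansion

variable {p : ℕ} {γ κ : Fin p → ℝ} {x : ℕ → Fin p → ℝ} {W : ℕ → Matrix (Fin p) (Fin p) ℝ}

theorem mul_sub_mul_isLittleO {a b c g : ℕ → ℝ} {a₀ : ℝ} (ha : Tendsto a atTop (𝓝 a₀))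
    (hbc : (fun n => b n - c n) =o[atTop] g) (hc : c =O[atTop] g) :
    (fun n => a n * b n - a₀ * c n) =o[atTop] g := by
  have h1 : (fun n => a n * (b n - c n)) =o[atTop] g := by
    simpa using (ha.isBigO_one ℝ).mul_isLittleO hbc
  have h2 : (fun n => (a n - a₀) * c n) =o[atTop] g := by
    have h3 : (fun n => a n - a₀) =o[atTop] fun _ => (1 : ℝ) := by
      rw [isLittleO_one_iff]
      simpa using ha.sub_const a₀
    simpa using h3.mul_isBigO hc
  exact (h1.add h2).congr_left fun n => by ring

theorem rHat_isBigO {k l : Fin p} (hkl : k ≠ l) :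
    (fun n => rHat (firstPoints x n) k l) =O[atTop] fun n => noise γ (firstPoints x n) :=
  isBigO_of_abs_le fun _ => abs_rHat_le_noise _ _ hkl

theorem qHat_isBigO {k l : Fin p} (hkl : k ≠ l) :
    (fun n => qHat γ (firstPoints x n) k l) =O[atTop] fun n => noise γ (firstPoints x n) :=
  isBigO_of_abs_le fun _ => abs_qHat_le_noise _ _ hkl

theorem sHat_isBigO {k l : Fin p} (hkl : k ≠ l) :
    (fun n => sHat (firstPoints x n) k l) =O[atTop] fun n => noise γ (firstPoints x n) :=
  isBigO_of_abs_le fun n => by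
    simpa [hkl] using abs_sHat_le_noise γ (firstPoints x n) k l

/-- Leading term of the expansion of an off-diagonal entry. -/
def leading {n : ℕ} (α : ℝ) (γ κ : Fin p → ℝ) (x : Fin n → Fin p → ℝ) (k l : Fin p) : ℝ :=
  (3 * α * psi1 γ x k l + 4 * (1 - α) * psi2 γ (fun k => κ k + 3) κ x k l) /
    (3 * α * (γ k ^ 2 + γ l ^ 2) + 4 * (1 - α) * (κ k ^ 2 + κ l ^ 2))

theorem leading_isBigO (α : ℝ) {k l : Fin p} (hkl : k ≠ l) :
    (fun n => leading α γ κ (firstPoints x n) k l) =O[atTop]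
      fun n => noise γ (firstPoints x n) := by
  have hr := rHat_isBigO (γ := γ) (x := x) hkl
  have hr' := rHat_isBigO (γ := γ) (x := x) hkl.symm
  have hq := qHat_isBigO (γ := γ) (x := x) hkl
  have hq' := qHat_isBigO (γ := γ) (x := x) hkl.symm
  have hs := sHat_isBigO (γ := γ) (x := x) hkl
  have h1 := ((hr.const_mul_left (γ k)).sub (hr'.const_mul_left (γ l))).sub
    (hs.const_mul_left (γ k ^ 2))
  have h2 := ((hq.const_mul_left (κ k)).sub (hq'.const_mul_left (κ l))).sub
    (hs.const_mul_left (κ k * (κ k + 3) - 3 * κ l))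
  have h3 := ((h1.const_mul_left (3 * α)).add (h2.const_mul_left (4 * (1 - α)))).const_mul_left
    (3 * α * (γ k ^ 2 + γ l ^ 2) + 4 * (1 - α) * (κ k ^ 2 + κ l ^ 2))⁻¹
  refine h3.congr_left fun n => ?_
  rw [leading, div_eq_inv_mul, psi1, psi2]

/-- Whitening reads `1 = ŝₖₖ + 2 (wₖₖ - 1)` up to the remainder. -/
theorem Standardizes.diag_expansion (h : Standardizes γ κ x W) (k : Fin p) :
    (fun n => (W n k k - 1) - -(1 / 2) * (sHat (firstPoints x n) k k - 1)) =o[atTop]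
      gauge γ x W := by
  refine ((h.c2_expansion k k).const_mul_left (-(1 / 2))).congr' ?_ EventuallyEq.rfl
  filter_upwards [h.std] with n hn
  rw [c2_of_standardized _ hn, if_pos rfl, Matrix.one_apply_eq]
  ring

/-- Two linear equations determine `wₖₗ` and `wₗₖ`: whitening gives `wₗₖ + wₖₗ + ŝₖₗ ≈ 0`, and
stationarity gives the other. Their determinant is the denominator of the leading term. -/
theorem Standardizes.offDiag_expansion (h : Standardizes γ κ x W) {α : ℝ}
    (hopt : ∀ᶠ n in atTop, IsOpt α (firstPoints x n) (W n)) {k l : Fin p} (hkl : k ≠ l)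
    (hD : 3 * α * (γ k ^ 2 + γ l ^ 2) + 4 * (1 - α) * (κ k ^ 2 + κ l ^ 2) ≠ 0) :
    (fun n => W n k l - leading α γ κ (firstPoints x n) k l) =o[atTop] gauge γ x W := by
  have hlk := hkl.symm
  have hb := noise_isBigO_gauge (γ := γ) (x := x) (W := W)
  have hsum : (fun n => W n l k + W n k l + sHat (firstPoints x n) k l) =o[atTop]
      gauge γ x W := by
    refine (h.c2_expansion k l).neg_left.congr' ?_ EventuallyEq.rfl
    filter_upwards [h.std] with n hn
    rw [c2_of_standardized _ hn, if_neg hkl, Matrix.one_apply_ne hkl, Matrix.one_apply_ne hlk]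
    ring
  have hm3 : ∀ k, Tendsto (fun n => c3 (firstPoints x n) (W n k) (W n k) (W n k)) atTop
      (𝓝 (γ k)) := fun k => by
    have := h.moments.three le_rfl (h.row k) (h.row k) (h.row k)
    simpa [Pi.single_apply] using this
  have hm4 : ∀ k, Tendsto (fun n => c4 (firstPoints x n) (W n k) (W n k) (W n k) (W n k) - 3) atTop
      (𝓝 (κ k)) := fun k => by
    have := (h.moments.four le_rfl (h.row k) (h.row k) (h.row k) (h.row k)).sub_const 3
    convert this using 2
    simp [Pi.single_apply]
    ring
  have key : ∀ k l, k ≠ l → (fun n =>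
      3 * α * (c3 (firstPoints x n) (W n k) (W n k) (W n k) *
          c3 (firstPoints x n) (W n k) (W n k) (W n l)) +
        4 * (1 - α) * ((c4 (firstPoints x n) (W n k) (W n k) (W n k) (W n k) - 3) *
          c4 (firstPoints x n) (W n k) (W n k) (W n k) (W n l)) -
        (3 * α * (γ k * (rHat (firstPoints x n) k l + γ k * W n l k)) +
          4 * (1 - α) * (κ k * (qHat γ (firstPoints x n) k l + (κ k + 3) * W n l k +
            3 * W n k l)))) =o[atTop] gauge γ x W := by
    intro k l hkl
    have e1 := offDiag_isBigO_gauge (γ := γ) (x := x) (W := W) hkl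
    have e2 := offDiag_isBigO_gauge (γ := γ) (x := x) (W := W) hkl.symm
    have h3 := mul_sub_mul_isLittleO (hm3 k) (h.c3_expansion hkl)
      (((rHat_isBigO (γ := γ) hkl).trans hb).add (e2.const_mul_left (γ k)))
    have h4 := mul_sub_mul_isLittleO (hm4 k) (h.c4_expansion hkl)
      ((((qHat_isBigO (γ := γ) hkl).trans hb).add (e2.const_mul_left (κ k + 3))).add
        (e1.const_mul_left 3))
    refine ((h3.const_mul_left (3 * α)).add (h4.const_mul_left (4 * (1 - α)))).congr_left
      fun n => ?_
    ring
  set D := 3 * α * (γ k ^ 2 + γ l ^ 2) + 4 * (1 - α) * (κ k ^ 2 + κ l ^ 2) with hDdef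
  -- The multiple of `hsum` is the coefficient of `wₗₖ` in the linearized stationarity equation. It
  -- eliminates `wₗₖ`, leaves `D` as coefficient of `wₖₗ`, and produces the `ŝₖₗ` terms of `psi1`
  -- and `psi2`.
  have hfin := ((((key k l hkl).sub (key l k hlk)).add
    (hsum.const_mul_left (3 * α * γ k ^ 2 + 4 * (1 - α) * (κ k * (κ k + 3) - 3 * κ l)))).const_mul_left
      D⁻¹)
  refine hfin.congr' ?_ EventuallyEq.rfl
  filter_upwards [hopt] with n hn
  have hfo := hn.first_order hkl
  rw [leading, psi1, psi2, ← hDdef, eq_sub_iff_add_eq, div_eq_inv_mul, ← mul_add,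
    inv_mul_eq_iff_eq_mul₀ hD, hDdef]
  linear_combination hfo

/-- If all entries have leading terms of the order of the noise and remainders of smaller order
than the gauge, then the remainders are of smaller order than the noise. -/
theorem gauge_isBigO_noise {main : ℕ → Fin p → Fin p → ℝ}
    (hmain : ∀ k l, (fun n => main n k l) =O[atTop] fun n => noise γ (firstPoints x n))
    (hrem : ∀ k l, (fun n => W n k l - (1 : Matrix (Fin p) (Fin p) ℝ) k l - main n k l) =o[atTop]
      gauge γ x W) :
    gauge γ x W =O[atTop] fun n => noise γ (firstPoints x n) := by
  have h1 : (fun n => ∑ k, ∑ l, |main n k l|) =O[atTop] fun n => noise γ (firstPoints x n) :=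
    IsBigO.fun_sum fun k _ => IsBigO.fun_sum fun l _ => (hmain k l).abs_left
  have h2 : (fun n => ∑ k, ∑ l,
      |W n k l - (1 : Matrix (Fin p) (Fin p) ℝ) k l - main n k l|) =o[atTop] gauge γ x W :=
    IsLittleO.fun_sum fun k _ => IsLittleO.fun_sum fun l _ => (hrem k l).abs_left
  obtain ⟨C, hC⟩ := h1.bound
  -- Eventually gauge ≤ `C` · noise + gauge / 2 + noise, and half of the gauge moves to the left.
  refine IsBigO.of_bound (2 * (C + 1)) ?_
  filter_upwards [hC, h2.bound (show (0 : ℝ) < 1 / 2 by norm_num)] with n hn1 hn2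
  have hb := noise_nonneg γ (firstPoints x n)
  have hd := deviation_nonneg (W n)
  have hg : 0 ≤ gauge γ x W n := add_nonneg hd hb
  rw [Real.norm_of_nonneg hb] at hn1 ⊢
  rw [Real.norm_of_nonneg hg] at hn2 ⊢
  have h3 : deviation (W n) ≤ ∑ k, ∑ l, |main n k l| + ∑ k, ∑ l,
      |W n k l - (1 : Matrix (Fin p) (Fin p) ℝ) k l - main n k l| := by
    simp only [deviation, ← Finset.sum_add_distrib]
    refine Finset.sum_le_sum fun k _ => Finset.sum_le_sum fun l _ => ?_
    have := abs_add_le (main n k l) (W n k l - (1 : Matrix (Fin p) (Fin p) ℝ) k l - main n k l)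
    rwa [add_sub_cancel] at this
  have h4 := le_of_abs_le (Real.norm_eq_abs _ ▸ hn1)
  have h5 := le_of_abs_le (Real.norm_eq_abs _ ▸ hn2)
  simp only [gauge] at h5 ⊢
  linarith

/-- The remainders are first known relative to the gauge, which contains the unknown deviation of
`W`. Since the leading terms are of the order of the noise, the gauge is too, and the remainders
improve accordingly. -/
theorem Standardizes.expansions (h : Standardizes γ κ x W) {α : ℝ}
    (hopt : ∀ᶠ n in atTop, IsOpt α (firstPoints x n) (W n))
    (hD : ∀ k l, k ≠ l → 3 * α * (γ k ^ 2 + γ l ^ 2) + 4 * (1 - α) * (κ k ^ 2 + κ l ^ 2) ≠ 0) :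
    (∀ k, (fun n => (W n k k - 1) - -(1 / 2) * (sHat (firstPoints x n) k k - 1)) =o[atTop]
      fun n => noise γ (firstPoints x n)) ∧
    ∀ k l, k ≠ l → (fun n => W n k l - leading α γ κ (firstPoints x n) k l) =o[atTop]
      fun n => noise γ (firstPoints x n) := by
  have hg : gauge γ x W =O[atTop] fun n => noise γ (firstPoints x n) := by
    refine gauge_isBigO_noise (main := fun n k l => if k = l then
      -(1 / 2) * (sHat (firstPoints x n) k k - 1) else leading α γ κ (firstPoints x n) k l) ?_ ?_
    · intro k l
      by_cases hkl : k = l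
      · simp only [if_pos hkl]
        refine IsBigO.const_mul_left (isBigO_of_abs_le fun n => ?_) _
        simpa using abs_sHat_le_noise γ (firstPoints x n) k k
      · simp only [if_neg hkl]
        exact leading_isBigO α hkl
    · intro k l
      by_cases hkl : k = l
      · subst hkl
        simpa only [if_true, Matrix.one_apply_eq] using h.diag_expansion k
      · simpa only [if_neg hkl, Matrix.one_apply_ne hkl, sub_zero] using
          h.offDiag_expansion hopt hkl (hD k l hkl)
  exact ⟨fun k => (h.diag_expansion k).trans_isBigO hg,
    fun k l hkl => (h.offDiag_expansion hopt hkl (hD k l hkl)).trans_isBigO hg⟩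

end Expansion

/-! ### Sequences bounded in mean and convergence in probability -/

section Probability

variable {Ω : Type*} [MeasurableSpace Ω] {P : Measure Ω}

/-- The sequence is bounded in `L¹`. -/
def BoundedInMean (P : Measure Ω) (X : ℕ → Ω → ℝ) : Prop :=
  ∃ C, ∀ n, Integrable (X n) P ∧ ∫ ω, |X n ω| ∂P ≤ C

theorem BoundedInMean.add {X Y : ℕ → Ω → ℝ} (hX : BoundedInMean P X) (hY : BoundedInMean P Y) :
    BoundedInMean P fun n ω => X n ω + Y n ω := by
  obtain ⟨C, hC⟩ := hX
  obtain ⟨D, hD⟩ := hY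
  refine ⟨C + D, fun n => ⟨(hC n).1.add (hD n).1, ?_⟩⟩
  refine le_trans ?_ (add_le_add (hC n).2 (hD n).2)
  rw [← integral_add (hC n).1.abs (hD n).1.abs]
  exact integral_mono ((hC n).1.add (hD n).1).abs ((hC n).1.abs.add (hD n).1.abs)
    fun ω => abs_add_le _ _

theorem boundedInMean_zero : BoundedInMean P fun _ _ => 0 := ⟨0, fun _ => by simp⟩

theorem BoundedInMean.sum {ι : Type*} {s : Finset ι} {X : ι → ℕ → Ω → ℝ}
    (h : ∀ i ∈ s, BoundedInMean P (X i)) : BoundedInMean P fun n ω => ∑ i ∈ s, X i n ω := by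
  classical
  induction s using Finset.induction_on with
  | empty => simpa using boundedInMean_zero
  | insert i s hi ih =>
    simp only [Finset.sum_insert hi]
    exact (h i (by simp)).add (ih fun j hj => h j (by simp [hj]))

theorem BoundedInMean.abs {X : ℕ → Ω → ℝ} (hX : BoundedInMean P X) :
    BoundedInMean P fun n ω => |X n ω| := by
  obtain ⟨C, hC⟩ := hX
  exact ⟨C, fun n => ⟨(hC n).1.abs, by simpa using (hC n).2⟩⟩

/-- A sequence that is almost surely of smaller order than a sequence bounded in mean converges to
zero in probability. -/
theorem isLittleOP_of_ae_isLittleO [IsProbabilityMeasure P] {X B : ℕ → Ω → ℝ}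
    (hX : ∀ n, AEStronglyMeasurable (X n) P) (hB : BoundedInMean P B) (hB0 : ∀ n ω, 0 ≤ B n ω)
    (h : ∀ᵐ ω ∂P, (fun n => X n ω) =o[atTop] fun n => B n ω) : IsLittleOP P X := by
  obtain ⟨C, hC⟩ := hB
  have hC0 : 0 ≤ C := (integral_nonneg fun ω => abs_nonneg _).trans (hC 0).2
  -- The ratio tends to zero almost surely, hence in probability; adding `1` avoids division by
  -- zero.
  have hY : TendstoInMeasure P (fun n ω => X n ω / (1 + B n ω)) atTop fun _ => (0 : ℝ) := by
    refine tendstoInMeasure_of_tendsto_ae (fun n => ?_) ?_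
    · exact (hX n).div₀ (aestronglyMeasurable_const.add (hC n).1.1)
    · filter_upwards [h] with ω hω
      have h1 : (fun n => B n ω) =O[atTop] fun n => 1 + B n ω :=
        IsBigO.of_bound 1 (Eventually.of_forall fun n => by
          rw [one_mul, Real.norm_of_nonneg (hB0 n ω),
            Real.norm_of_nonneg (add_nonneg zero_le_one (hB0 n ω))]
          linarith)
      exact (hω.trans_isBigO h1).tendsto_div_nhds_zero
  rw [IsLittleOP, tendstoInMeasure_iff_measureReal_norm]
  rw [tendstoInMeasure_iff_measureReal_norm] at hY
  intro ε hε
  rw [Metric.tendsto_atTop]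
  intro δ hδ
  -- Markov's inequality gives probability at most `C / K < δ / 2` to the event `K ≤ B n`; the
  -- summand `1` keeps `K` positive when `C = 0`. Off this event a large `X n` forces a large ratio.
  set K : ℝ := 2 * C / δ + 1 with hK
  have hK0 : 0 < K := by positivity
  have hKC : C / K < δ / 2 := by
    rw [div_lt_iff₀ hK0, hK]
    have : δ / 2 * (2 * C / δ + 1) = C + δ / 2 := by field_simp
    linarith
  obtain ⟨N, hN⟩ := (Metric.tendsto_atTop.1 (hY (ε / (1 + K)) (by positivity))) (δ / 2)
    (by positivity)
  refine ⟨N, fun n hn => ?_⟩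
  have h1 := hN n hn
  rw [Real.dist_eq, sub_zero, abs_of_nonneg measureReal_nonneg] at h1 ⊢
  have h2 : P.real {ω | K ≤ B n ω} ≤ C / K := by
    rw [le_div_iff₀ hK0, mul_comm]
    refine (mul_meas_ge_le_integral_of_nonneg (ae_of_all _ (hB0 n)) (hC n).1 K).trans ?_
    have : ∫ ω, B n ω ∂P = ∫ ω, |B n ω| ∂P := by simp only [abs_of_nonneg (hB0 n _)]
    rw [this]
    exact (hC n).2
  have h3 : {ω | ε ≤ ‖X n ω - 0‖} ⊆
      {ω | ε / (1 + K) ≤ ‖X n ω / (1 + B n ω) - 0‖} ∪ {ω | K ≤ B n ω} := by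
    intro ω hω
    by_cases hb : K ≤ B n ω
    · exact Or.inr hb
    · left
      have hω' : ε ≤ ‖X n ω - 0‖ := hω
      have h0 := hB0 n ω
      change ε / (1 + K) ≤ ‖X n ω / (1 + B n ω) - 0‖
      rw [sub_zero] at hω' ⊢
      rw [norm_div, Real.norm_of_nonneg (add_nonneg zero_le_one h0)]
      exact div_le_div₀ (norm_nonneg _) hω' (by positivity) (by linarith)
  calc P.real {ω | ε ≤ ‖X n ω - 0‖} ≤ _ := measureReal_mono h3
    _ ≤ _ := measureReal_union_le _ _
    _ < δ := by linarith

/-! ### Root-`n` bounds for sample means -/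

variable {p : ℕ} {z : ℕ → Ω → Fin p → ℝ}

/-- Root-`n` scaled sample means of centered square-integrable functions are bounded in mean. -/
theorem boundedInMean_sqrt_mul_emean [IsProbabilityMeasure P] (hindep : iIndepFun z P)
    (hident : ∀ i, IdentDistrib (z i) (z 0) P P) {ξ : (Fin p → ℝ) → ℝ} (hξ : Measurable ξ)
    (h2 : MemLp (fun ω => ξ (z 0 ω)) 2 P) (h0 : ∫ ω, ξ (z 0 ω) ∂P = 0) :
    BoundedInMean P fun n ω => √(n : ℝ) * emean (sample z n ω) ξ := by
  have hid : ∀ i, IdentDistrib (fun ω => ξ (z i ω)) (fun ω => ξ (z 0 ω)) P P := fun i =>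
    (hident i).comp hξ
  have hm : ∀ i, MemLp (fun ω => ξ (z i ω)) 2 P := fun i => (hid i).memLp_iff.2 h2
  have hsum : ∀ n : ℕ, MemLp (fun ω => ∑ i ∈ Finset.range n, ξ (z i ω)) 2 P := fun n =>
    memLp_finsetSum _ fun i _ => hm i
  have he : ∀ (n : ℕ) ω, emean (sample z n ω) ξ =
      (n : ℝ)⁻¹ * ∑ i ∈ Finset.range n, ξ (z i ω) := fun n ω => by
    rw [emean, ← Fin.sum_univ_eq_sum_range (fun i => ξ (z i ω))]
    rfl
  have hmean : ∀ n : ℕ, ∫ ω, ∑ i ∈ Finset.range n, ξ (z i ω) ∂P = 0 := fun n => by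
    rw [integral_finsetSum _ fun i _ => (hm i).integrable (by norm_num)]
    exact Finset.sum_eq_zero fun i _ => by rw [(hid i).integral_eq, h0]
  have hvar : ∀ n : ℕ, ∫ ω, (∑ i ∈ Finset.range n, ξ (z i ω)) ^ 2 ∂P =
      n * ∫ ω, ξ (z 0 ω) ^ 2 ∂P := fun n => by
    have e1 := IndepFun.variance_sum (μ := P) (X := fun i ω => ξ (z i ω)) (s := Finset.range n)
      (fun i _ => hm i) (fun i _ j _ hij => (hindep.indepFun hij).comp hξ hξ)
    rw [variance_of_integral_eq_zero (by simpa [Finset.sum_fn] using (hsum n).1.aemeasurable)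
      (by simpa using hmean n)] at e1
    have e2 : ∀ i, variance (fun ω => ξ (z i ω)) P = ∫ ω, ξ (z 0 ω) ^ 2 ∂P := fun i => by
      rw [(hid i).variance_eq, variance_of_integral_eq_zero h2.1.aemeasurable h0]
    simpa [e2] using e1
  refine ⟨1 + ∫ ω, ξ (z 0 ω) ^ 2 ∂P, fun n => ?_⟩
  have hint : Integrable (fun ω => √(n : ℝ) * emean (sample z n ω) ξ) P := by
    simp only [he]
    exact (((hsum n).integrable (by norm_num)).const_mul _).const_mul _
  have hσ : 0 ≤ ∫ ω, ξ (z 0 ω) ^ 2 ∂P := integral_nonneg fun ω => sq_nonneg _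
  refine ⟨hint, ?_⟩
  have hsq : Integrable (fun ω => (n : ℝ)⁻¹ * (∑ i ∈ Finset.range n, ξ (z i ω)) ^ 2) P :=
    (hsum n).integrable_sq.const_mul _
  calc ∫ ω, |√(n : ℝ) * emean (sample z n ω) ξ| ∂P
      ≤ ∫ ω, (1 + (n : ℝ)⁻¹ * (∑ i ∈ Finset.range n, ξ (z i ω)) ^ 2) ∂P := by
        refine integral_mono hint.abs ((integrable_const 1).add hsq) fun ω => ?_
        -- The bound `|t| ≤ 1 + t²` reduces the `L¹` norm to the variance of the sum, which is
        -- linear in `n` by independence.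
        have h1 : |√(n : ℝ) * emean (sample z n ω) ξ| ≤
            1 + (√(n : ℝ) * emean (sample z n ω) ξ) ^ 2 := by
          rw [← sq_abs (√(n : ℝ) * emean (sample z n ω) ξ)]
          nlinarith [sq_nonneg (|√(n : ℝ) * emean (sample z n ω) ξ| - 1),
            abs_nonneg (√(n : ℝ) * emean (sample z n ω) ξ)]
        refine h1.trans (le_of_eq ?_)
        rw [he, mul_pow, Real.sq_sqrt (Nat.cast_nonneg n)]
        rcases Nat.eq_zero_or_pos n with rfl | hn
        · simp
        · have : (n : ℝ) ≠ 0 := by exact_mod_cast hn.ne'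
          field_simp
    _ = 1 + (n : ℝ)⁻¹ * (n * ∫ ω, ξ (z 0 ω) ^ 2 ∂P) := by
        rw [integral_add (integrable_const 1) hsq, integral_const_mul, hvar]
        simp
    _ ≤ 1 + ∫ ω, ξ (z 0 ω) ^ 2 ∂P := by
        rcases Nat.eq_zero_or_pos n with rfl | hn
        · simpa using hσ
        · have : (n : ℝ) ≠ 0 := by exact_mod_cast hn.ne'
          rw [inv_mul_cancel_left₀ this]

variable {Z : Ω → Fin p → ℝ}

theorem IsStandard.measurable_apply (h : IsStandard P Z) (k : Fin p) :
    Measurable fun ω => Z ω k :=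
  (measurable_pi_apply k).comp h.meas

theorem IsStandard.indepFun (h : IsStandard P Z) {k l : Fin p} (hkl : k ≠ l) :
    IndepFun (fun ω => Z ω k) (fun ω => Z ω l) P :=
  h.indep.indepFun hkl

/-- By independence the square of the product is integrable once both squares are, without the loss
of Hölder's inequality. This is why sixth moments suffice even for `q̂ₖₗ`, where a cube is
multiplied by another component. -/
theorem IsStandard.memLp_mul (h : IsStandard P Z) [IsProbabilityMeasure P] {k l : Fin p}
    (hkl : k ≠ l) {φ : ℝ → ℝ} (hφ : Measurable φ) (hm : MemLp (fun ω => φ (Z ω k)) 2 P) :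
    MemLp (fun ω => φ (Z ω k) * Z ω l) 2 P := by
  have hk := h.measurable_apply k
  have hl := h.measurable_apply l
  have hkl' : Measurable fun ω => φ (Z ω k) * Z ω l := (hφ.comp hk).mul hl
  rw [memLp_two_iff_integrable_sq hkl'.aestronglyMeasurable]
  have h2 : MemLp (fun ω => Z ω l) 2 P := (h.mem l).mono_exponent (by norm_num)
  have hi : IndepFun (fun ω => φ (Z ω k) ^ 2) (fun ω => Z ω l ^ 2) P :=
    (h.indepFun hkl).comp (hφ.pow_const 2) (measurable_id.pow_const 2)
  refine (hi.integrable_mul hm.integrable_sq h2.integrable_sq).congr (ae_of_all _ fun ω => ?_)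
  simp only [Pi.mul_apply]; ring

theorem IsStandard.integral_mul_eq_zero (h : IsStandard P Z) {k l : Fin p}
    (hkl : k ≠ l) {φ : ℝ → ℝ} (hφ : Measurable φ) : ∫ ω, φ (Z ω k) * Z ω l ∂P = 0 := by
  have hi : IndepFun (fun ω => φ (Z ω k)) (fun ω => Z ω l) P :=
    (h.indepFun hkl).comp hφ measurable_id
  rw [hi.integral_fun_mul_eq_mul_integral (hφ.comp (h.measurable_apply k)).aestronglyMeasurable
    (h.measurable_apply l).aestronglyMeasurable, h.mean, mul_zero]

theorem IsStandard.memLp_pow (h : IsStandard P Z) [IsProbabilityMeasure P] (k : Fin p) {m : ℕ}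
    (hm0 : m ≠ 0) (hm : m ≤ 3) : MemLp (fun ω => Z ω k ^ m) 2 P := by
  have hk := h.measurable_apply k
  rw [memLp_two_iff_integrable_sq (hk.pow_const m).aestronglyMeasurable]
  have h2 : MemLp (fun ω => Z ω k) ((2 * m : ℕ) : ℝ≥0∞) P :=
    (h.mem k).mono_exponent (by
      have : 2 * m ≤ 6 := by omega
      exact_mod_cast this)
  have := h2.integrable_norm_pow (by omega)
  refine this.congr (ae_of_all _ fun ω => ?_)
  simp only [Real.norm_eq_abs]
  rw [pow_mul, sq_abs, ← pow_mul, ← pow_mul, mul_comm]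

/-- Root-`n` scaled noise is bounded in mean. -/
theorem boundedInMean_noise [IsProbabilityMeasure P] (hindep : iIndepFun z P)
    (hident : ∀ i, IdentDistrib (z i) (z 0) P P) (h : IsStandard P (z 0)) (γ : Fin p → ℝ) :
    BoundedInMean P fun n ω => √(n : ℝ) * noise γ (sample z n ω) := by
  have hx : ∀ k, BoundedInMean P fun n ω => √(n : ℝ) * xbar (sample z n ω) k := fun k =>
    boundedInMean_sqrt_mul_emean hindep hident (measurable_pi_apply k)
      ((h.mem k).mono_exponent (by norm_num)) (h.mean k)
  have hs : ∀ k l, BoundedInMean P fun n ω =>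
      √(n : ℝ) * (sHat (sample z n ω) k l - if k = l then 1 else 0) := fun k l => by
    have hm : MemLp (fun ω => z 0 ω k * z 0 ω l - if k = l then 1 else 0) 2 P := by
      refine MemLp.sub ?_ (memLp_const _)
      by_cases hkl : k = l
      · subst hkl
        simpa only [sq] using h.memLp_pow k (m := 2) (by norm_num) (by norm_num)
      · exact h.memLp_mul hkl measurable_id ((h.mem k).mono_exponent (by norm_num))
    have hi : Integrable (fun ω => z 0 ω k * z 0 ω l) P := by
      have := (hm.integrable (by norm_num)).add (integrable_const (if k = l then (1 : ℝ) else 0))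
      exact this.congr (ae_of_all _ fun ω => by simp only [Pi.add_apply, sub_add_cancel])
    have := boundedInMean_sqrt_mul_emean hindep hident
      (ξ := fun y => y k * y l - if k = l then 1 else 0) (by fun_prop) hm (by
        rw [integral_sub hi (integrable_const _), h.integral_two]; simp)
    convert this using 3 with n ω
    rcases Nat.eq_zero_or_pos n with rfl | hn
    · simp
    · rw [emean_sub, emean_const _ hn.ne']; rfl
  have hr : ∀ k l, k ≠ l → BoundedInMean P fun n ω => √(n : ℝ) * rHat (sample z n ω) k l :=
    fun k l hkl => boundedInMean_sqrt_mul_emean hindep hident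
      (ξ := fun y => (y k ^ 2 - 1) * y l) (by fun_prop)
      (h.memLp_mul hkl (φ := fun t => t ^ 2 - 1) (by fun_prop)
        ((h.memLp_pow k (by norm_num) (by norm_num)).sub (memLp_const 1)))
      (h.integral_mul_eq_zero hkl (φ := fun t => t ^ 2 - 1) (by fun_prop))
  have hq : ∀ k l, k ≠ l → BoundedInMean P fun n ω => √(n : ℝ) * qHat γ (sample z n ω) k l :=
    fun k l hkl => boundedInMean_sqrt_mul_emean hindep hident
      (ξ := fun y => (y k ^ 3 - γ k) * y l) (by fun_prop)
      (h.memLp_mul hkl (φ := fun t => t ^ 3 - γ k) (by fun_prop)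
        ((h.memLp_pow k (by norm_num) (by norm_num)).sub (memLp_const (γ k))))
      (h.integral_mul_eq_zero hkl (φ := fun t => t ^ 3 - γ k) (by fun_prop))
  have key : BoundedInMean P fun n ω => ∑ k, |√(n : ℝ) * xbar (sample z n ω) k| +
      ∑ k, ∑ l, (|√(n : ℝ) * (sHat (sample z n ω) k l - if k = l then 1 else 0)| +
        if k = l then 0 else |√(n : ℝ) * rHat (sample z n ω) k l| +
          |√(n : ℝ) * qHat γ (sample z n ω) k l|) := by
    refine BoundedInMean.add (BoundedInMean.sum fun k _ => (hx k).abs)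
      (BoundedInMean.sum fun k _ => BoundedInMean.sum fun l _ => (hs k l).abs.add ?_)
    by_cases hkl : k = l
    · simpa only [if_pos hkl] using boundedInMean_zero
    · simpa only [if_neg hkl] using (hr k l hkl).abs.add (hq k l hkl).abs
  convert key using 3 with n ω
  have : ∀ t : ℝ, |√(n : ℝ) * t| = √(n : ℝ) * |t| := fun t => by
    rw [abs_mul, abs_of_nonneg (Real.sqrt_nonneg _)]
  simp only [this, noise, mul_add, Finset.mul_sum, mul_ite, mul_zero]

end Probability

/-! ### From sample paths to probability -/

section Main

variable {Ω : Type*} [MeasurableSpace Ω] {P : Measure Ω} {p : ℕ} {z : ℕ → Ω → Fin p → ℝ}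

theorem measurable_sHat {n : ℕ} (k l : Fin p) :
    Measurable fun x : Fin n → Fin p → ℝ => sHat x k l := by
  unfold sHat; fun_prop

theorem measurable_leading {n : ℕ} (α : ℝ) (γ κ : Fin p → ℝ) (k l : Fin p) :
    Measurable fun x : Fin n → Fin p → ℝ => leading α γ κ x k l := by
  unfold leading psi1 psi2 rHat qHat sHat; fun_prop

/-- Existence of a consistent sequence of solutions with linear expansions, for every weight in
`[0, 1]`. -/
theorem exists_consistent_solutionSequence [IsProbabilityMeasure P]
    (hmeas : ∀ i, Measurable (z i)) (hindep : iIndepFun z P)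
    (hident : ∀ i, IdentDistrib (z i) (z 0) P P) (h : IsStandard P (z 0)) {α : ℝ} (h0 : 0 ≤ α)
    (h1 : α ≤ 1)
    (hc : ∀ k l, α * gam P (z 0) k ^ 2 + (1 - α) * kap P (z 0) k ^ 2 = 0 →
      α * gam P (z 0) l ^ 2 + (1 - α) * kap P (z 0) l ^ 2 = 0 → k = l) :
    ∃ W : (n : ℕ) → (Fin n → Fin p → ℝ) → Matrix (Fin p) (Fin p) ℝ,
      IsSolutionSequence α W ∧
      TendstoInProb P (fun n ω => W n (sample z n ω)) 1 ∧
      (∀ k, IsLittleOP P fun n ω => √(n : ℝ) * (W n (sample z n ω) k k - 1) -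
        (-(1 / 2) * (√(n : ℝ) * (sHat (sample z n ω) k k - 1)))) ∧
      (∀ k l, l ≠ k → IsLittleOP P fun n ω => √(n : ℝ) * W n (sample z n ω) k l -
        √(n : ℝ) * leading α (gam P (z 0)) (kap P (z 0)) (sample z n ω) k l) := by
  obtain ⟨W, hW, hclose⟩ := exists_solutionSequence p α
  have hsample : ∀ n, Measurable fun ω => sample z n ω := fun n =>
    measurable_pi_lambda _ fun i => hmeas i
  have hWm : ∀ n k l, Measurable fun ω => W n (sample z n ω) k l := fun n k l =>
    ((hW n).1 k l).comp (hsample n)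
  -- All terms are nonnegative, so a zero denominator makes the coefficient `α γ² + (1 - α) κ²`
  -- vanish at both `k` and `l`, against `hc`.
  have hD : ∀ k l, k ≠ l → 3 * α * (gam P (z 0) k ^ 2 + gam P (z 0) l ^ 2) +
      4 * (1 - α) * (kap P (z 0) k ^ 2 + kap P (z 0) l ^ 2) ≠ 0 := by
    intro k l hkl he
    have a1 := mul_nonneg h0 (sq_nonneg (gam P (z 0) k))
    have a2 := mul_nonneg h0 (sq_nonneg (gam P (z 0) l))
    have a3 := mul_nonneg (sub_nonneg.2 h1) (sq_nonneg (kap P (z 0) k))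
    have a4 := mul_nonneg (sub_nonneg.2 h1) (sq_nonneg (kap P (z 0) l))
    exact hkl (hc k l (by linarith) (by linarith))
  -- Everything deterministic is applied on the almost sure event where the moments converge. There
  -- the sample covariance is eventually positive definite, so `W n` is optimal from some `n` on.
  have hpath : ∀ᵐ ω ∂P, Standardizes (gam P (z 0)) (kap P (z 0)) (fun i => z i ω)
      (fun n => W n (sample z n ω)) ∧
      ∀ᶠ n in atTop, IsOpt α (firstPoints (fun i => z i ω) n) (W n (sample z n ω)) := by
    filter_upwards [ae_momentsConverge hindep hident h.mem_four] with ω hω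
    have hx := hω.centered h
    have hev : ∀ᶠ n in atTop, IsOpt α (firstPoints (fun i => z i ω) n) (W n (sample z n ω)) ∧
        ∀ V, IsOpt α (firstPoints (fun i => z i ω) n) V →
          distOne (W n (sample z n ω)) ≤ distOne V := by
      filter_upwards [hx.eventually_posDef] with n hn
      exact hclose n _ hn
    exact ⟨⟨hx, hx.tendsto_one h0 h1 hc hev, hev.mono fun n hn => hn.1.1⟩,
      hev.mono fun n hn => hn.1⟩
  have hB := boundedInMean_noise hindep hident h (gam P (z 0))
  have hB0 : ∀ n ω, 0 ≤ √((n : ℕ) : ℝ) * noise (gam P (z 0)) (sample z n ω) := fun n ω =>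
    mul_nonneg (Real.sqrt_nonneg _) (noise_nonneg _ _)
  refine ⟨W, hW, fun k l => ?_, fun k => ?_, fun k l hlk => ?_⟩
  · refine tendstoInMeasure_of_tendsto_ae (fun n => (hWm n k l).aestronglyMeasurable) ?_
    filter_upwards [hpath] with ω hω
    exact tendsto_pi_nhds.1 (tendsto_pi_nhds.1 hω.1.lim k) l
  · refine isLittleOP_of_ae_isLittleO (fun n => ?_) hB hB0 ?_
    · exact (((hWm n k k).sub_const 1).const_mul _ |>.sub
        (((((measurable_sHat k k).comp (hsample n)).sub_const 1).const_mul _).const_mul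
          _)).aestronglyMeasurable
    · filter_upwards [hpath] with ω hω
      have := (isBigO_refl (fun n : ℕ => √(n : ℝ)) atTop).mul_isLittleO
        ((hω.1.expansions hω.2 hD).1 k)
      exact this.congr_left fun n => by
        change √(n : ℝ) * (_ - -(1 / 2) * (sHat (sample z n ω) k k - 1)) = _
        ring
  · refine isLittleOP_of_ae_isLittleO (fun n => ?_) hB hB0 ?_
    · exact ((hWm n k l).const_mul _ |>.sub
        (((measurable_leading α _ _ k l).comp (hsample n)).const_mul _)).aestronglyMeasurable
    · filter_upwards [hpath] with ω hω
      have := (isBigO_refl (fun n : ℕ => √(n : ℝ)) atTop).mul_isLittleO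
        ((hω.1.expansions hω.2 hD).2 k l hlk.symm)
      exact this.congr_left fun n => mul_sub _ _ _

theorem mul_leading_eq {n : ℕ} (α c : ℝ) (x : Fin n → Fin p → ℝ) (k l : Fin p) :
    c * leading α (gam P (z 0)) (kap P (z 0)) x k l =
      (3 * α * (c * psi1 (gam P (z 0)) x k l) +
        4 * (1 - α) * (c * psi2 (gam P (z 0)) (bet P (z 0)) (kap P (z 0)) x k l)) /
      (3 * α * (gam P (z 0) k ^ 2 + gam P (z 0) l ^ 2) +
        4 * (1 - α) * (kap P (z 0) k ^ 2 + kap P (z 0) l ^ 2)) := by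
  have hb : (fun k => kap P (z 0) k + 3) = bet P (z 0) := by ext k; simp [kap]
  rw [leading, hb]
  ring

end Main

end SymPP
end

/-! ### Specialization to the three ranges of the weight -/

theorem mainTheorem3 {p : ℕ} {Ω : Type*} [MeasurableSpace Ω] (P : Measure Ω)
    [IsProbabilityMeasure P] (z : ℕ → Ω → Fin p → ℝ)
    -- a random sample
    (hmeas : ∀ i, Measurable (z i))
    (hindep : iIndepFun z P)
    (hident : ∀ i, IdentDistrib (z i) (z 0) P P)
    -- with standardized and mutually independent components
    (hcomp : iIndepFun (fun k ω => z 0 ω k) P)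
    (hmean : ∀ k, ∫ ω, z 0 ω k ∂P = 0)
    (hvar : ∀ k, ∫ ω, z 0 ω k ^ 2 ∂P = 1) :
    -- (i) skewness only
    ((∀ k, MemLp (fun ω => z 0 ω k) 6 P) →
      (∀ k l, SymPP.gam P (z 0) k = 0 → SymPP.gam P (z 0) l = 0 → k = l) →
      ∃ W : (n : ℕ) → (Fin n → Fin p → ℝ) → Matrix (Fin p) (Fin p) ℝ,
        SymPP.IsSolutionSequence 1 W ∧
        SymPP.TendstoInProb P (fun n ω => W n (SymPP.sample z n ω)) 1 ∧
        (∀ k, SymPP.IsLittleOP P fun n ω =>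
          √(n : ℝ) * (W n (SymPP.sample z n ω) k k - 1) -
            (-(1 / 2) * (√(n : ℝ) * (SymPP.sHat (SymPP.sample z n ω) k k - 1)))) ∧
        (∀ k l, l ≠ k → SymPP.IsLittleOP P fun n ω =>
          √(n : ℝ) * W n (SymPP.sample z n ω) k l -
            √(n : ℝ) * SymPP.psi1 (SymPP.gam P (z 0)) (SymPP.sample z n ω) k l /
              (SymPP.gam P (z 0) k ^ 2 + SymPP.gam P (z 0) l ^ 2))) ∧
    -- (ii) kurtosis only
    ((∀ k, MemLp (fun ω => z 0 ω k) 8 P) →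
      (∀ k l, SymPP.kap P (z 0) k = 0 → SymPP.kap P (z 0) l = 0 → k = l) →
      ∃ W : (n : ℕ) → (Fin n → Fin p → ℝ) → Matrix (Fin p) (Fin p) ℝ,
        SymPP.IsSolutionSequence 0 W ∧
        SymPP.TendstoInProb P (fun n ω => W n (SymPP.sample z n ω)) 1 ∧
        (∀ k, SymPP.IsLittleOP P fun n ω =>
          √(n : ℝ) * (W n (SymPP.sample z n ω) k k - 1) -
            (-(1 / 2) * (√(n : ℝ) * (SymPP.sHat (SymPP.sample z n ω) k k - 1)))) ∧
        (∀ k l, l ≠ k → SymPP.IsLittleOP P fun n ω =>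
          √(n : ℝ) * W n (SymPP.sample z n ω) k l -
            √(n : ℝ) * SymPP.psi2 (SymPP.gam P (z 0)) (SymPP.bet P (z 0)) (SymPP.kap P (z 0))
                (SymPP.sample z n ω) k l /
              (SymPP.kap P (z 0) k ^ 2 + SymPP.kap P (z 0) l ^ 2))) ∧
    -- (iii) both skewness and kurtosis
    (∀ α : ℝ, 0 < α → α < 1 →
      (∀ k, MemLp (fun ω => z 0 ω k) 8 P) →
      (∀ k l, (SymPP.gam P (z 0) k = 0 ∧ SymPP.kap P (z 0) k = 0) →
        (SymPP.gam P (z 0) l = 0 ∧ SymPP.kap P (z 0) l = 0) → k = l) →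
      ∃ W : (n : ℕ) → (Fin n → Fin p → ℝ) → Matrix (Fin p) (Fin p) ℝ,
        SymPP.IsSolutionSequence α W ∧
        SymPP.TendstoInProb P (fun n ω => W n (SymPP.sample z n ω)) 1 ∧
        (∀ k, SymPP.IsLittleOP P fun n ω =>
          √(n : ℝ) * (W n (SymPP.sample z n ω) k k - 1) -
            (-(1 / 2) * (√(n : ℝ) * (SymPP.sHat (SymPP.sample z n ω) k k - 1)))) ∧
        (∀ k l, l ≠ k → SymPP.IsLittleOP P fun n ω =>
          √(n : ℝ) * W n (SymPP.sample z n ω) k l -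
            (3 * α * (√(n : ℝ) * SymPP.psi1 (SymPP.gam P (z 0)) (SymPP.sample z n ω) k l) +
              4 * (1 - α) * (√(n : ℝ) * SymPP.psi2 (SymPP.gam P (z 0)) (SymPP.bet P (z 0))
                (SymPP.kap P (z 0)) (SymPP.sample z n ω) k l)) /
              (3 * α * (SymPP.gam P (z 0) k ^ 2 + SymPP.gam P (z 0) l ^ 2) +
                4 * (1 - α) * (SymPP.kap P (z 0) k ^ 2 + SymPP.kap P (z 0) l ^ 2)))) := by
  have hstd : (∀ k, MemLp (fun ω => z 0 ω k) 6 P) → SymPP.IsStandard P (z 0) := fun h6 =>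
    ⟨hmeas 0, hcomp, hmean, hvar, h6⟩
  have h86 : (∀ k, MemLp (fun ω => z 0 ω k) 8 P) → ∀ k, MemLp (fun ω => z 0 ω k) 6 P :=
    fun h8 k => (h8 k).mono_exponent (by norm_num)
  refine ⟨fun h6 hc => ?_, fun h8 hc => ?_, fun α h0 h1 h8 hc => ?_⟩
  · obtain ⟨W, h1, h2, h3, h4⟩ := SymPP.exists_consistent_solutionSequence hmeas hindep hident
      (hstd h6) zero_le_one le_rfl (fun k l hk hl => hc k l (by simpa using hk) (by simpa using hl))
    refine ⟨W, h1, h2, h3, fun k l hlk => ?_⟩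
    convert h4 k l hlk using 4 with n ω
    -- At weight one the kurtosis terms drop out and the common factor `3` cancels; at weight zero,
    -- below, the factor `4` cancels in the same way.
    rw [SymPP.mul_leading_eq, sub_self, mul_zero, zero_mul, zero_mul, add_zero, add_zero, mul_one,
      mul_div_mul_left _ _ three_ne_zero]
  · obtain ⟨W, h1, h2, h3, h4⟩ := SymPP.exists_consistent_solutionSequence hmeas hindep hident
      (hstd (h86 h8)) le_rfl zero_le_one
      (fun k l hk hl => hc k l (by simpa using hk) (by simpa using hl))
    refine ⟨W, h1, h2, h3, fun k l hlk => ?_⟩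
    convert h4 k l hlk using 4 with n ω
    rw [SymPP.mul_leading_eq, sub_zero, mul_zero, zero_mul, zero_mul, zero_add, zero_add, mul_one,
      mul_div_mul_left _ _ four_ne_zero]
  -- Both weights are strictly positive, so the combined coefficient vanishes only if both cumulants
  -- do.
  · have hz : ∀ k, α * SymPP.gam P (z 0) k ^ 2 + (1 - α) * SymPP.kap P (z 0) k ^ 2 = 0 →
        SymPP.gam P (z 0) k = 0 ∧ SymPP.kap P (z 0) k = 0 := fun k hk => by
      have a1 := mul_nonneg h0.le (sq_nonneg (SymPP.gam P (z 0) k))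
      have a2 := mul_nonneg (sub_pos.2 h1).le (sq_nonneg (SymPP.kap P (z 0) k))
      have b1 : α * SymPP.gam P (z 0) k ^ 2 = 0 := by linarith
      have b2 : (1 - α) * SymPP.kap P (z 0) k ^ 2 = 0 := by linarith
      simpa [h0.ne', (sub_pos.2 h1).ne'] using And.intro b1 b2
    obtain ⟨W, hW1, hW2, hW3, hW4⟩ := SymPP.exists_consistent_solutionSequence hmeas hindep hident
      (hstd (h86 h8)) h0.le h1.le (fun k l hk hl => hc k l (hz k hk) (hz l hl))
    refine ⟨W, hW1, hW2, hW3, fun k l hlk => ?_⟩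
    convert hW4 k l hlk using 4 with n ω
    rw [SymPP.mul_leading_eq]
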